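/- **Setting.** Let $t_{\rm end}>0$ and let $\mathcal V,\mathcal H$ be real Hilbert spaces of finite dimension with the same elements but possibly different norms, $\mathcal V\subseteq\mathcal H\subseteq\mathcal V^\star$ being the associated Gelfand triple (so $v\in\mathcal V$ is identified with the functional $w\mapsto\langle v,w\rangle_{\mathcal H}$). Let $\mathbb A\colon\mathcal V\to\mathcal V^\star$ be linear, bounded, $\|\mathbb Av\|_{\mathcal V^\star}\le C\|v\|_{\mathcal V}$, and coercive, $\langle\mathbb Av,v\rangle\ge c\|v\|_{\mathcal V}^2$, with $c,C>0$ (no symmetry is assumed), and let the inverse inequality $\|v\|_{\mathcal V}\le C_{\rm inv}h^{-2s}\|v\|_{\mathcal V^\star}$ hold for all $v\in\mathcal V$, with parameters $h,s>0$. Let $\mathcal T_0$ be a partition of $[0,t_{\rm end}]$ into finitely many nondegenerate compact intervals, $u_0\in\mathcal H$, and let $f$ be piecewise affine in time on $\mathcal T_0$ with values in $\mathcal V^\star$ (jumps at the nodes are allowed). Consider $\partial_tu+\mathbb Au=f$ in $[0,t_{\rm end}]$, $u(0)=u_0$. Assume the CFL-type condition $h^{2s}/\max_{T\in\mathcal T_0}|T|\ge\kappa$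 with $\kappa>0$. Meshes are refined by bisecting intervals at their midpoints; $\mathbb T$ is the set of all meshes obtained from $\mathcal T_0$ by iterated bisection, and $\widehat{\mathcal T}$ is a refinement of $\mathcal T$ if it arises from $\mathcal T$ by iterated bisection. Let $\mathcal X=L^2(0,t_{\rm end};\mathcal V)\cap H^1(0,t_{\rm end};\mathcal V^\star)$ with $\|v\|_{\mathcal X}^2=\|v\|^2_{L^2(0,t_{\rm end};\mathcal V)}+\|\partial_tv\|^2_{L^2(0,t_{\rm end};\mathcal V^\star)}$. For $\mathcal T\in\mathbb T$, the Crank–Nicolson approximation $u_{\mathcal T}\in\mathcal X$ is affine in $t$ on each $T\in\mathcal T$, satisfies $u_{\mathcal T}(0)=u_0$, and $$\frac{u_{\mathcal T}(b)-u_{\mathcal T}(a)}{b-a}+\mathbb Au_{\mathcal T}\Big(\frac{a+b}2\Big)=f\Big(\frac{a+b}2\Big)\quad\text{for all }T=[a,b]\in\mathcal T.$$ The error estimator is $\eta(\mathcal T)=\big(\sum_{T\in\mathcal T}\eta_T(\mathcal T)^2\big)^{1/2}$ with $\eta_T(\mathcal T)=|T|\,\|\partial_tf-\partial_t\mathbb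 Au_{\mathcal T}\|_{L^2(T;\mathcal V^\star)}$. *Adaptive algorithm* with parameter $\theta\in(0,1)$: starting from $\mathcal T_0$, for $\ell=0,1,2,\dots$ compute $u_{\mathcal T_\ell}$ and $\eta_T(\mathcal T_\ell)$, choose $\mathcal M_\ell\subseteq\mathcal T_\ell$ of minimal cardinality with $\sum_{T\in\mathcal M_\ell}\eta_T(\mathcal T_\ell)^2\ge\theta\,\eta(\mathcal T_\ell)^2$, and obtain $\mathcal T_{\ell+1}$ from $\mathcal T_\ell$ by bisecting exactly the elements of $\mathcal M_\ell$. Consider the following properties, for all $\mathcal T\in\mathbb T$ and all refinements $\widehat{\mathcal T}$ of $\mathcal T$: * (A1) $\big|\big(\sum_{T\in\mathcal S}\eta_T(\widehat{\mathcal T})^2\big)^{1/2}-\big(\sum_{T\in\mathcal S}\eta_T(\mathcal T)^2\big)^{1/2}\big|\le C_{\rm stab}\|u_{\mathcal T}-u_{\widehat{\mathcal T}}\|_{\mathcal X}$ for all $\mathcal S\subseteq\mathcal T\cap\widehat{\mathcal T}$; * (A2) $\sum_{T\in\widehat{\mathcal T}\setminus\mathcal T}\eta_T(\widehat{\mathcal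 T})^2\le q_{\rm red}\sum_{T\in\mathcal T\setminus\widehat{\mathcal T}}\eta_T(\mathcal T)^2+C_{\rm red}\|u_{\mathcal T}-u_{\widehat{\mathcal T}}\|_{\mathcal X}^2$; * (A4) there is $\mathcal R$ with $\mathcal T\setminus\widehat{\mathcal T}\subseteq\mathcal R\subseteq\mathcal T$, $\#\mathcal R\le C_{\rm ref}\,\#(\mathcal T\setminus\widehat{\mathcal T})$ and $\|u_{\widehat{\mathcal T}}-u_{\mathcal T}\|_{\mathcal X}^2\le C_{\rm dlr}^2\sum_{T\in\mathcal R}\eta_T(\mathcal T)^2$. **Theorem 8.6.** Fix $t_{\rm end},\mathcal T_0,c,C,C_{\rm inv},\kappa$ as above. 1. For every problem as above with these parameters and every $\mathcal T\in\mathbb T$, the Crank–Nicolson approximation $u_{\mathcal T}$ exists and is unique, and (A1), (A2), (A4) hold with constants $C_{\rm stab},C_{\rm red},C_{\rm ref},C_{\rm dlr}\ge1$ and $0\le q_{\rm red}<1$ that depend only on $t_{\rm end},\mathcal T_0,c,C,C_{\rm inv},\kappa$. 2. Let $C_{\rm stab},C_{\rm ref},C_{\rm dlr}\ge1$ be any constants,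 let $0<\theta<\theta_\star:=(1+C_{\rm stab}^2C_{\rm dlr}^2)^{-1}$ and let $r>0$. There is a constant $C_{\rm opt}>0$, depending only on $t_{\rm end},\mathcal T_0,c,C,C_{\rm inv},\kappa,C_{\rm stab},C_{\rm ref},C_{\rm dlr},\theta,r$, such that for every problem as above with these parameters for which (A1) and (A4) hold with these constants, the adaptive algorithm is rate-optimal: if $$C_{\rm best}:=\sup_{N\in\mathbb N\cup\{0\}}\ \inf_{\substack{\mathcal T\in\mathbb T\\ \#\mathcal T-\#\mathcal T_0\le N}}\eta(\mathcal T)(N+1)^r<\infty,$$ then every sequence $(\mathcal T_\ell)$ produced by the algorithm satisfies $$\sup_{\ell\in\mathbb N\cup\{0\}}\eta(\mathcal T_\ell)\,(\#\mathcal T_\ell)^r\le C_{\rm opt}\,C_{\rm best}<\infty.$$ -/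

import Mathlib

open MeasureTheory Set
open scoped ENNReal

noncomputable section

namespace AdaptiveTime

/-! ### Time meshes and bisection -/

/-- A time mesh is a finite set of compact intervals; the pair `(a, b)` stands for `[a, b]`. -/
abbrev TimeMesh := Finset (ℝ × ℝ)

/-- `𝒯` is a partition of `[0, tEnd]` into nondegenerate compact intervals. -/
structure IsPartition (tEnd : ℝ) (𝒯 : TimeMesh) : Prop where
  nondegenerate : ∀ T ∈ 𝒯, T.1 < T.2
  cover : (⋃ T ∈ 𝒯, Icc T.1 T.2) = Icc 0 tEnd
  disjoint_interiors : (𝒯 : Set (ℝ × ℝ)).PairwiseDisjoint fun T => Ioo T.1 T.2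

/-- The midpoint of a time interval. -/
def mid (T : ℝ × ℝ) : ℝ := (T.1 + T.2) / 2

/-- The two descendants of a time interval under bisection. -/
def children (T : ℝ × ℝ) : TimeMesh := {(T.1, mid T), (mid T, T.2)}

/-- The mesh obtained from `𝒯` by bisecting each element of `ℳ` (used for `ℳ ⊆ 𝒯`) once. -/
def bisect (𝒯 ℳ : TimeMesh) : TimeMesh := (𝒯 \ ℳ) ∪ ℳ.biUnion children

/-- `Refines 𝒯 𝒯'`: the mesh `𝒯'` is obtained from `𝒯` by iterated bisection.  The set of
admissible meshes generated by an initial mesh `𝒯₀` is `{𝒯 | Refines 𝒯₀ 𝒯}`. -/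
def Refines (𝒯 𝒯' : TimeMesh) : Prop :=
  Relation.ReflTransGen (fun 𝒮 𝒮' : TimeMesh => ∃ ℳ ⊆ 𝒮, 𝒮' = bisect 𝒮 ℳ) 𝒯 𝒯'

/-! ### The parabolic problem -/

/-- The data of `∂ₜ u + 𝔸 u = f` in `[0, tEnd]`, `u(0) = u₀`, where `V` and `H` have the same
elements (identified by `ι`) but carry different Hilbert space norms, and where the dual `V*`
carries the dual norm. -/
structure ParabolicProblem (V H : Type*) [NormedAddCommGroup V] [InnerProductSpace ℝ V]
    [NormedAddCommGroup H] [InnerProductSpace ℝ H] (tEnd : ℝ) where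
  ι : V ≃ₗ[ℝ] H
  A : V →L[ℝ] StrongDual ℝ V
  f : ℝ → StrongDual ℝ V
  u₀ : H

namespace ParabolicProblem

variable {V H : Type*} [NormedAddCommGroup V] [InnerProductSpace ℝ V] [FiniteDimensional ℝ V]
  [NormedAddCommGroup H] [InnerProductSpace ℝ H] {tEnd : ℝ} (P : ParabolicProblem V H tEnd)

/-- The embedding `V ⊆ V*` of the Gelfand triple `V ⊆ H ⊆ V*`: `(J v) w = ⟨v, w⟩_H`. -/
def J : V →ₗ[ℝ] StrongDual ℝ V :=
  (LinearMap.toContinuousLinearMap : (V →ₗ[ℝ] ℝ) ≃ₗ[ℝ] (V →L[ℝ] ℝ)).toLinearMap ∘ₗ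
    (innerₗ H).compl₁₂ P.ι.toLinearMap P.ι.toLinearMap

theorem J_apply (v w : V) : P.J v w = inner ℝ (P.ι v) (P.ι w) := rfl

/-- Membership in `𝒳 = L²(0, tEnd; V) ∩ H¹(0, tEnd; V*)`.  A function belongs to
`H¹(0, tEnd; V*)` iff (its continuous representative) is absolutely continuous with values
in `V*` and has a square integrable derivative. -/
structure MemX (v : ℝ → V) : Prop where
  memLp : MemLp v 2 (volume.restrict (Icc 0 tEnd))
  absolutelyContinuous : AbsolutelyContinuousOnInterval (fun t => P.J (v t)) 0 tEnd
  memLp_deriv : MemLp (deriv fun t => P.J (v t)) 2 (volume.restrict (Icc 0 tEnd))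

/-- The norm of `𝒳`: `‖v‖² = ‖v‖²_{L²(0,tEnd;V)} + ‖∂ₜ v‖²_{L²(0,tEnd;V*)}`. -/
def normX (v : ℝ → V) : ℝ :=
  Real.sqrt ((∫ t in (0 : ℝ)..tEnd, ‖v t‖ ^ 2) +
    ∫ t in (0 : ℝ)..tEnd, ‖deriv (fun τ => P.J (v τ)) t‖ ^ 2)

/-- Membership in the trial space `𝒳_𝒯 = {v ∈ 𝒳 | v is affine in t on every T ∈ 𝒯}`. -/
structure MemXT (𝒯 : TimeMesh) (v : ℝ → V) : Prop where
  memX : P.MemX v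
  affine : ∀ T ∈ 𝒯, ∃ p q : V, ∀ t ∈ Icc T.1 T.2, v t = p + t • q

/-- `v` solves the Crank–Nicolson scheme on the mesh `𝒯`. -/
structure IsCrankNicolson (𝒯 : TimeMesh) (v : ℝ → V) : Prop where
  mem : P.MemXT 𝒯 v
  initial : P.ι (v 0) = P.u₀
  step : ∀ T ∈ 𝒯,
    (T.2 - T.1)⁻¹ • P.J (v T.2 - v T.1) + P.A (v (mid T)) = P.f (mid T)

/-- The Crank–Nicolson approximation `u_𝒯` (a solution of the scheme on `𝒯`; it is determined
on `[0, tEnd]` whenever the scheme is uniquely solvable). -/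
def cn (𝒯 : TimeMesh) : ℝ → V := Classical.epsilon (P.IsCrankNicolson 𝒯)

/-- The local contribution `η_T(𝒯) = |T| ‖∂ₜ f - ∂ₜ 𝔸 u_𝒯‖_{L²(T;V*)}`. -/
def etaT (𝒯 : TimeMesh) (T : ℝ × ℝ) : ℝ :=
  (T.2 - T.1) * Real.sqrt (∫ t in T.1..T.2,
    ‖deriv P.f t - deriv (fun τ => P.A (P.cn 𝒯 τ)) t‖ ^ 2)

/-- The error estimator `η(𝒯)`. -/
def eta (𝒯 : TimeMesh) : ℝ := Real.sqrt (∑ T ∈ 𝒯, P.etaT 𝒯 T ^ 2)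

/-- The standing assumptions on the data: `𝔸` is coercive with constant `c` and bounded by `C`,
the inverse inequality holds with constant `Cinv` and parameters `h`, `s`, the ratio
`h^{2s} / max_{T ∈ 𝒯₀} |T|` is at least `κ`, and `f` is piecewise affine on `𝒯₀`
(possibly discontinuous at the nodes of `𝒯₀`). -/
structure IsAdmissible (𝒯₀ : TimeMesh) (c C Cinv κ h s : ℝ) : Prop where
  coercive : ∀ v : V, c * ‖v‖ ^ 2 ≤ P.A v v
  bounded : ∀ v : V, ‖P.A v‖ ≤ C * ‖v‖
  inverse : ∀ v : V, ‖v‖ ≤ Cinv * h ^ (-(2 * s)) * ‖P.J v‖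
  cfl : ∀ T ∈ 𝒯₀, κ ≤ h ^ (2 * s) / (T.2 - T.1)
  f_affine : ∀ T ∈ 𝒯₀, ∃ p q : StrongDual ℝ V, ∀ t ∈ Ioo T.1 T.2, P.f t = p + t • q

/-! ### Properties of the estimator (for all admissible meshes and their refinements) -/

/-- Stability on non-refined elements, with constant `Cstab`. -/
def A1 (𝒯₀ : TimeMesh) (Cstab : ℝ) : Prop :=
  ∀ 𝒯 𝒯' : TimeMesh, Refines 𝒯₀ 𝒯 → Refines 𝒯 𝒯' → ∀ 𝒮 ⊆ 𝒯 ∩ 𝒯',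
    |Real.sqrt (∑ T ∈ 𝒮, P.etaT 𝒯' T ^ 2) - Real.sqrt (∑ T ∈ 𝒮, P.etaT 𝒯 T ^ 2)|
      ≤ Cstab * P.normX (fun t => P.cn 𝒯 t - P.cn 𝒯' t)

/-- Reduction on refined elements, with constants `qred` and `Cred`. -/
def A2 (𝒯₀ : TimeMesh) (qred Cred : ℝ) : Prop :=
  ∀ 𝒯 𝒯' : TimeMesh, Refines 𝒯₀ 𝒯 → Refines 𝒯 𝒯' →
    ∑ T ∈ 𝒯' \ 𝒯, P.etaT 𝒯' T ^ 2 ≤ qred * ∑ T ∈ 𝒯 \ 𝒯', P.etaT 𝒯 T ^ 2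
      + Cred * P.normX (fun t => P.cn 𝒯 t - P.cn 𝒯' t) ^ 2

/-- Discrete reliability, with constants `Cref` and `Cdlr`. -/
def A4 (𝒯₀ : TimeMesh) (Cref Cdlr : ℝ) : Prop :=
  ∀ 𝒯 𝒯' : TimeMesh, Refines 𝒯₀ 𝒯 → Refines 𝒯 𝒯' →
    ∃ ℛ ⊆ 𝒯, 𝒯 \ 𝒯' ⊆ ℛ ∧ (ℛ.card : ℝ) ≤ Cref * (𝒯 \ 𝒯').card ∧
      P.normX (fun t => P.cn 𝒯' t - P.cn 𝒯 t) ^ 2 ≤ Cdlr ^ 2 * ∑ T ∈ ℛ, P.etaT 𝒯 T ^ 2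

/-! ### The adaptive algorithm and the best possible rate -/

/-- `ℳ ⊆ 𝒯` satisfies the Dörfler marking criterion with parameter `θ`. -/
def IsDoerfler (θ : ℝ) (𝒯 ℳ : TimeMesh) : Prop :=
  ℳ ⊆ 𝒯 ∧ θ * ∑ T ∈ 𝒯, P.etaT 𝒯 T ^ 2 ≤ ∑ T ∈ ℳ, P.etaT 𝒯 T ^ 2

/-- `(𝒯 ℓ)` is a sequence of meshes produced by the adaptive algorithm started from `𝒯₀` with
parameter `θ`: `ℳ ℓ` is a Dörfler set of minimal cardinality for the estimator computed from
the Crank–Nicolson approximation on `𝒯 ℓ`, and precisely the marked elements are bisected. -/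
structure IsAdaptiveRun (𝒯₀ : TimeMesh) (θ : ℝ) (𝒯 ℳ : ℕ → TimeMesh) : Prop where
  init : 𝒯 0 = 𝒯₀
  mark : ∀ ℓ, P.IsDoerfler θ (𝒯 ℓ) (ℳ ℓ)
  mark_minimal : ∀ ℓ, ∀ ℳ' : TimeMesh, P.IsDoerfler θ (𝒯 ℓ) ℳ' → (ℳ ℓ).card ≤ ℳ'.card
  refine : ∀ ℓ, 𝒯 (ℓ + 1) = bisect (𝒯 ℓ) (ℳ ℓ)

/-- `C_best(r) = sup_N inf {η(𝒯) (N+1)^r | 𝒯 admissible, #𝒯 - #𝒯₀ ≤ N} ∈ [0, ∞]`. -/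
def Cbest (𝒯₀ : TimeMesh) (r : ℝ) : ℝ≥0∞ :=
  ⨆ N : ℕ, ⨅ 𝒯 ∈ {𝒯 : TimeMesh | Refines 𝒯₀ 𝒯 ∧ 𝒯.card ≤ 𝒯₀.card + N},
    ENNReal.ofReal (P.eta 𝒯 * ((N : ℝ) + 1) ^ r)

end ParabolicProblem

end AdaptiveTime

end

open AdaptiveTime

/-!
The difference `d` of the Crank–Nicolson approximations on a mesh `𝒯` and on a refinement `𝒯'`
vanishes initially and solves the scheme on `𝒯'` with the right-hand side
`(mid X - mid T) (∂ₜ f - ∂ₜ 𝔸 u_𝒯)` on each `X ∈ 𝒯'` contained in `T ∈ 𝒯`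
(`IsStable.cnResidual_cnDiff`). This right-hand side is at most `|T|` times the estimator density
on `T`, and it vanishes on elements that are not refined. Testing with the midpoint values (`energy_estimate`) therefore
gives discrete reliability with `ℛ = 𝒯 \ 𝒯'`. Stability and reduction are elementary, since the
inverse inequality and the CFL condition provide `‖v‖_V ≤ K ‖v‖_{V*}`, where `K` may depend on the
initial mesh and all elements have length at most `tEnd`.

For rate optimality, linear convergence is proved without any quasi-orthogonality. On the two
halves of a bisected element the right-hand sides above cancel, so the piecewise affine interpolant
of `d` on the coarse mesh is smaller than `d` by a factor of the length of the bisected elements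
(`IsStable.sum_coarse_slope_le`). If all marked elements have length at most a fixed small `δ`,
the perturbation of the estimator is thus small on all elements: on the bisected ones because
these are short, on the others because there `d` coincides with its coarse interpolant. Dörfler
marking then contracts the estimator (`IsStable.eta_bisect_le`). Bisecting a longer element lowers
`∑ |T|²` by at least `δ² / 2`, which can happen only a bounded number of times, and by
quasi-monotonicity the estimator grows by at most a fixed factor in such a step. An exponential
weight in `∑ |T|²` combines the two cases (`exists_linear_convergence`).

The rest is a counting argument. A mesh that is optimal for a tolerance proportional to `η(𝒯_ℓ)`
is overlaid with `𝒯_ℓ` (`Refines.exists_overlay`). The overlay reduces the estimator by a fixed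
factor, so for `θ < θ⋆` the set from discrete reliability satisfies the Dörfler criterion
(`exists_isDoerfler`). By minimality this bounds the number of marked elements
(`IsAdaptiveRun.card_marked_le`). Bisection in time has no closure overhead, and linear convergence
turns the sum over all steps into a geometric series (`IsAdaptiveRun.rate`).
-/

namespace AdaptiveTime

/-! ### Meshes as ordered tilings -/

/-- `Tiling t 𝒯` says that `𝒯` is a partition of `[0, t]`, built by appending intervals on the
right; the empty mesh is the tiling of `[0, 0]`.  It is the induction principle behind all
arguments that step forward in time. -/
inductive Tiling : ℝ → TimeMesh → Prop
  | empty : Tiling 0 ∅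
  | snoc {a b : ℝ} {𝒯 : TimeMesh} : Tiling a 𝒯 → a < b → Tiling b (insert (a, b) 𝒯)

/-- The elements of `𝒯` are nondegenerate and do not overlap. -/
structure IsNonoverlapping (𝒯 : TimeMesh) : Prop where
  lt : ∀ T ∈ 𝒯, T.1 < T.2
  sep : ∀ T ∈ 𝒯, ∀ T' ∈ 𝒯, T = T' ∨ T.2 ≤ T'.1 ∨ T'.2 ≤ T.1

theorem Tiling.bounds {t : ℝ} {𝒯 : TimeMesh} (h : Tiling t 𝒯) :
    0 ≤ t ∧ ∀ T ∈ 𝒯, 0 ≤ T.1 ∧ T.1 < T.2 ∧ T.2 ≤ t := by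
  induction h with
  | empty => simp
  | snoc h hab ih =>
    refine ⟨by linarith [ih.1], fun T hT => ?_⟩
    rcases Finset.mem_insert.1 hT with rfl | hT
    · exact ⟨ih.1, hab, le_rfl⟩
    · have := ih.2 T hT
      exact ⟨this.1, this.2.1, by linarith [this.2.2]⟩

theorem Tiling.notMem {a b : ℝ} {𝒯 : TimeMesh} (h : Tiling a 𝒯) (hab : a < b) :
    (a, b) ∉ 𝒯 := fun hm => absurd (h.bounds.2 _ hm).2.2 (not_le.2 hab)

theorem Tiling.isNonoverlapping {t : ℝ} {𝒯 : TimeMesh} (h : Tiling t 𝒯) :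
    IsNonoverlapping 𝒯 := by
  refine ⟨fun T hT => (h.bounds.2 T hT).2.1, ?_⟩
  induction h with
  | empty => simp
  | snoc h hab ih =>
    intro T hT T' hT'
    rcases Finset.mem_insert.1 hT with rfl | hT <;> rcases Finset.mem_insert.1 hT' with rfl | hT'
    · exact Or.inl rfl
    · exact Or.inr (Or.inr (h.bounds.2 T' hT').2.2)
    · exact Or.inr (Or.inl (h.bounds.2 T hT).2.2)
    · exact ih T hT T' hT'

theorem IsNonoverlapping.eq_of_subset {𝒯 : TimeMesh} (h : IsNonoverlapping 𝒯) {T T' X : ℝ × ℝ}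
    (hT : T ∈ 𝒯) (hT' : T' ∈ 𝒯) (hX : X.1 < X.2) (h1 : T.1 ≤ X.1) (h2 : X.2 ≤ T.2)
    (h3 : T'.1 ≤ X.1) (h4 : X.2 ≤ T'.2) : T = T' := by
  rcases h.sep T hT T' hT' with h | h | h
  · exact h
  · linarith
  · linarith

/-- A finite family of nonoverlapping intervals in `[0, t]` that covers `[0, t)` is a tiling. The
half-open cover is inherited by the family without its last element. -/
theorem Tiling.of_cover (n : ℕ) : ∀ {t : ℝ} {𝒯 : TimeMesh}, 𝒯.card = n → 0 ≤ t →
    IsNonoverlapping 𝒯 → (∀ T ∈ 𝒯, 0 ≤ T.1 ∧ T.2 ≤ t) →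
    (∀ x ∈ Ico 0 t, ∃ T ∈ 𝒯, x ∈ Icc T.1 T.2) → Tiling t 𝒯 := by
  induction n with
  | zero =>
    intro t 𝒯 hn ht _ _ hcov
    obtain rfl := Finset.card_eq_zero.1 hn
    rcases ht.eq_or_lt with rfl | ht
    · exact .empty
    · obtain ⟨T, hT, -⟩ := hcov 0 ⟨le_rfl, ht⟩
      simp at hT
  | succ n ih =>
    intro t 𝒯 hn _ hno hb hcov
    have hne : 𝒯.Nonempty := Finset.card_pos.1 (by omega)
    obtain ⟨T, hT, hmax⟩ := Finset.exists_max_image 𝒯 (fun T => T.2) hne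
    have hlt := hno.lt T hT
    have hTt : T.2 = t := by
      by_contra hne
      have hlt' : T.2 < t := lt_of_le_of_ne (hb T hT).2 hne
      have h0 := (hb T hT).1
      obtain ⟨T', hT', hx⟩ := hcov ((T.2 + t) / 2) ⟨by linarith, by linarith⟩
      linarith [hmax T' hT', hx.2]
    have hother : ∀ T' ∈ 𝒯.erase T, T'.2 ≤ T.1 := by
      intro T' hT'
      obtain ⟨hne, hT'⟩ := Finset.mem_erase.1 hT'
      rcases hno.sep T' hT' T hT with h | h | h
      · exact absurd h hne
      · exact h
      · linarith [hmax T' hT', hno.lt T' hT']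
    have hE : Tiling T.1 (𝒯.erase T) := by
      refine ih (by rw [Finset.card_erase_of_mem hT, hn]; rfl) (hb T hT).1 ?_ ?_ ?_
      · exact ⟨fun X hX => hno.lt X (Finset.mem_of_mem_erase hX), fun X hX Y hY =>
          hno.sep X (Finset.mem_of_mem_erase hX) Y (Finset.mem_of_mem_erase hY)⟩
      · exact fun X hX => ⟨(hb X (Finset.mem_of_mem_erase hX)).1, hother X hX⟩
      · intro x hx
        obtain ⟨X, hX, hxX⟩ := hcov x ⟨hx.1, by linarith [hx.2]⟩
        refine ⟨X, Finset.mem_erase.2 ⟨?_, hX⟩, hxX⟩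
        rintro rfl
        linarith [hx.2, hxX.1]
    have := hE.snoc hlt
    rwa [Prod.mk.eta, Finset.insert_erase hT, hTt] at this

theorem IsPartition.tiling {tEnd : ℝ} (htEnd : 0 < tEnd) {𝒯 : TimeMesh}
    (h : IsPartition tEnd 𝒯) : Tiling tEnd 𝒯 := by
  refine Tiling.of_cover _ rfl htEnd.le ⟨h.nondegenerate, ?_⟩ ?_ ?_
  · intro T hT T' hT'
    by_contra! hcon
    obtain ⟨hne, h1, h2⟩ := hcon
    have hd := h.disjoint_interiors hT hT' hne
    have hT1 := h.nondegenerate T hT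
    have hT2 := h.nondegenerate T' hT'
    obtain ⟨x, hx1, hx2⟩ := exists_between
      (show max T.1 T'.1 < min T.2 T'.2 from max_lt (lt_min hT1 h2) (lt_min h1 hT2))
    exact Set.disjoint_left.1 hd
      (show x ∈ Ioo T.1 T.2 from ⟨(le_max_left _ _).trans_lt hx1, hx2.trans_le (min_le_left _ _)⟩)
      ⟨(le_max_right _ _).trans_lt hx1, hx2.trans_le (min_le_right _ _)⟩
  · intro T hT
    have hT1 := (h.nondegenerate T hT).le
    have hsub : Icc T.1 T.2 ⊆ Icc 0 tEnd := by
      rw [← h.cover]; exact Set.subset_biUnion_of_mem (u := fun T : ℝ × ℝ => Icc T.1 T.2) hT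
    exact ⟨(hsub ⟨le_rfl, hT1⟩).1, (hsub ⟨hT1, le_rfl⟩).2⟩
  · intro x hx
    have : x ∈ ⋃ T ∈ 𝒯, Icc T.1 T.2 := by rw [h.cover]; exact ⟨hx.1, hx.2.le⟩
    simpa only [mem_iUnion, exists_prop] using this

theorem Tiling.nonempty {t : ℝ} {𝒯 : TimeMesh} (h : Tiling t 𝒯) (ht : 0 < t) : 𝒯.Nonempty := by
  cases h with
  | empty => exact absurd ht (lt_irrefl _)
  | snoc => exact Finset.insert_nonempty _ _

theorem Tiling.sum_length {t : ℝ} {𝒯 : TimeMesh} (h : Tiling t 𝒯) :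
    ∑ T ∈ 𝒯, (T.2 - T.1) = t := by
  induction h with
  | empty => simp
  | snoc h hab ih => rw [Finset.sum_insert (h.notMem hab), ih]; simp

/-! ### Bisection -/

theorem mem_children {T X : ℝ × ℝ} : X ∈ children T ↔ X = (T.1, mid T) ∨ X = (mid T, T.2) := by
  simp [children]

theorem mem_bisect {𝒯 ℳ : TimeMesh} {X : ℝ × ℝ} :
    X ∈ bisect 𝒯 ℳ ↔ (X ∈ 𝒯 ∧ X ∉ ℳ) ∨ ∃ T ∈ ℳ, X ∈ children T := by
  simp [bisect]

theorem mid_sub_fst (T : ℝ × ℝ) : mid T - T.1 = (T.2 - T.1) / 2 := by unfold mid; ring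

theorem snd_sub_mid (T : ℝ × ℝ) : T.2 - mid T = (T.2 - T.1) / 2 := by unfold mid; ring

theorem children_spec {T X : ℝ × ℝ} (hT : T.1 < T.2) (hX : X ∈ children T) :
    T.1 ≤ X.1 ∧ X.1 < X.2 ∧ X.2 ≤ T.2 ∧ X.2 - X.1 = (T.2 - T.1) / 2 := by
  rcases mem_children.1 hX with rfl | rfl <;> simp only [mid] <;>
    exact ⟨by linarith, by linarith, by linarith, by ring⟩

theorem Tiling.bisect {t : ℝ} {𝒯 : TimeMesh} (h : Tiling t 𝒯) :
    ∀ {ℳ : TimeMesh}, ℳ ⊆ 𝒯 → Tiling t (bisect 𝒯 ℳ) := by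
  induction h with
  | empty =>
    intro ℳ hℳ
    obtain rfl := Finset.subset_empty.1 hℳ
    exact .empty
  | @snoc a b 𝒯 h hab ih =>
    intro ℳ hℳ
    by_cases hm : (a, b) ∈ ℳ
    · have hsub : ℳ.erase (a, b) ⊆ 𝒯 := Finset.subset_insert_iff.1 hℳ
      have h1 := ((ih hsub).snoc (b := mid (a, b)) (by simp only [mid]; linarith)).snoc (b := b)
        (by simp only [mid]; linarith)
      convert h1 using 1
      ext X
      simp only [mem_bisect, Finset.mem_insert, mem_children, Finset.mem_erase]
      have := h.notMem hab
      constructor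
      · rintro (⟨rfl | h1, h2⟩ | ⟨T, hT, hX⟩)
        · exact absurd hm h2
        · exact Or.inr (Or.inr (Or.inl ⟨h1, fun h => h2 h.2⟩))
        · by_cases hTe : T = (a, b)
          · subst hTe; tauto
          · exact Or.inr (Or.inr (Or.inr ⟨T, ⟨hTe, hT⟩, hX⟩))
      · rintro (h1 | h1 | ⟨h1, h2⟩ | ⟨T, hT, hX⟩)
        · exact Or.inr ⟨_, hm, Or.inr h1⟩
        · exact Or.inr ⟨_, hm, Or.inl h1⟩
        · refine Or.inl ⟨Or.inr h1, fun h3 => h2 ⟨?_, h3⟩⟩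
          rintro rfl
          exact this h1
        · exact Or.inr ⟨T, hT.2, hX⟩
    · have hsub : ℳ ⊆ 𝒯 := (Finset.subset_insert_iff_of_notMem hm).1 hℳ
      convert (ih hsub).snoc hab using 1
      ext X
      simp only [mem_bisect, Finset.mem_insert]
      constructor
      · tauto
      · rintro (rfl | h) <;> tauto

theorem Refines.tiling {t : ℝ} {𝒯 𝒯' : TimeMesh} (h : Tiling t 𝒯) (hr : Refines 𝒯 𝒯') :
    Tiling t 𝒯' := by
  induction hr with
  | refl => exact h
  | tail _ hs ih =>
    obtain ⟨ℳ, hℳ, rfl⟩ := hs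
    exact ih.bisect hℳ

theorem Refines.trans {𝒯 𝒯' 𝒯'' : TimeMesh} (h : Refines 𝒯 𝒯') (h' : Refines 𝒯' 𝒯'') :
    Refines 𝒯 𝒯'' := Relation.ReflTransGen.trans h h'

theorem Refines.bisect {𝒯 ℳ : TimeMesh} (hℳ : ℳ ⊆ 𝒯) : Refines 𝒯 (bisect 𝒯 ℳ) :=
  Relation.ReflTransGen.single ⟨ℳ, hℳ, rfl⟩

theorem IsNonoverlapping.children_notMem {𝒯 : TimeMesh} (h : IsNonoverlapping 𝒯) {T X : ℝ × ℝ}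
    (hT : T ∈ 𝒯) (hX : X ∈ children T) : X ∉ 𝒯 := by
  intro hX'
  have hlt := h.lt T hT
  obtain ⟨h1, h2, h3, h4⟩ := children_spec hlt hX
  obtain rfl := h.eq_of_subset hT hX' h2 h1 h3 le_rfl le_rfl
  linarith

theorem IsNonoverlapping.sum_bisect {M : Type*} [AddCommMonoid M] {𝒯 ℳ : TimeMesh}
    (h : IsNonoverlapping 𝒯) (hℳ : ℳ ⊆ 𝒯) (φ : ℝ × ℝ → M) :
    ∑ T ∈ bisect 𝒯 ℳ, φ T =
      ∑ T ∈ 𝒯 \ ℳ, φ T + ∑ T ∈ ℳ, (φ (T.1, mid T) + φ (mid T, T.2)) := by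
  rw [AdaptiveTime.bisect, Finset.sum_union, Finset.sum_biUnion]
  · congr 1
    refine Finset.sum_congr rfl fun T hT => ?_
    have hlt := h.lt T (hℳ hT)
    rw [children, Finset.sum_pair]
    intro he
    have := congrArg Prod.fst he
    simp only [mid] at this
    linarith
  · intro T hT T' hT' hne
    refine Finset.disjoint_left.2 fun X hX hX' => hne ?_
    obtain ⟨h1, h2, h3, -⟩ := children_spec (h.lt T (hℳ hT)) hX
    obtain ⟨h1', -, h3', -⟩ := children_spec (h.lt T' (hℳ hT')) hX'
    exact h.eq_of_subset (hℳ hT) (hℳ hT') h2 h1 h3 h1' h3'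
  · refine Finset.disjoint_left.2 fun X hX hX' => ?_
    obtain ⟨T, hT, hXT⟩ := Finset.mem_biUnion.1 hX'
    exact h.children_notMem (hℳ hT) hXT (Finset.mem_sdiff.1 hX).1

theorem IsNonoverlapping.card_bisect {𝒯 ℳ : TimeMesh} (h : IsNonoverlapping 𝒯) (hℳ : ℳ ⊆ 𝒯) :
    (bisect 𝒯 ℳ).card = 𝒯.card + ℳ.card := by
  have := h.sum_bisect hℳ fun _ => 1
  simp only [Finset.sum_const, smul_eq_mul, mul_one] at this
  rw [this, ← Finset.card_sdiff_add_card_eq_card hℳ]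
  omega

theorem Refines.card_sdiff_add_card_le {t : ℝ} {𝒯 𝒯' : TimeMesh} (h : Tiling t 𝒯)
    (hr : Refines 𝒯 𝒯') : (𝒯 \ 𝒯').card + 𝒯.card ≤ 𝒯'.card := by
  induction hr with
  | refl => simp
  | @tail 𝒮 𝒯' hr hs ih =>
    obtain ⟨ℳ, hℳ, rfl⟩ := hs
    rw [(Refines.tiling h hr).isNonoverlapping.card_bisect hℳ]
    have : 𝒯 \ AdaptiveTime.bisect 𝒮 ℳ ⊆ (𝒯 \ 𝒮) ∪ ℳ := by
      intro X hX
      simp only [Finset.mem_sdiff, mem_bisect, Finset.mem_union] at hX ⊢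
      tauto
    have := (Finset.card_le_card this).trans (Finset.card_union_le _ _)
    omega

/-! ### Overlays -/

theorem IsNonoverlapping.bisect_bisect {𝒯 ℳ ℳ' : TimeMesh} (h : IsNonoverlapping 𝒯)
    (hℳ : ℳ ⊆ 𝒯) (hℳ' : ℳ' ⊆ 𝒯) :
    ℳ' \ ℳ ⊆ bisect 𝒯 ℳ ∧ bisect (bisect 𝒯 ℳ) (ℳ' \ ℳ) = bisect 𝒯 (ℳ ∪ ℳ') := by
  constructor
  · intro X hX
    obtain ⟨h1, h2⟩ := Finset.mem_sdiff.1 hX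
    exact mem_bisect.2 (Or.inl ⟨hℳ' h1, h2⟩)
  · ext X
    have hc : ∀ T ∈ ℳ, X ∈ children T → X ∉ ℳ' := fun T hT hX hX' =>
      h.children_notMem (hℳ hT) hX (hℳ' hX')
    simp only [mem_bisect, Finset.mem_union, Finset.mem_sdiff]
    constructor
    · rintro (⟨⟨h1, h2⟩ | ⟨T, hT, hX⟩, h3⟩ | ⟨T, ⟨hT, -⟩, hX⟩)
      · left; tauto
      · exact Or.inr ⟨T, Or.inl hT, hX⟩
      · exact Or.inr ⟨T, Or.inr hT, hX⟩
    · rintro (⟨h1, h2⟩ | ⟨T, hT, hX⟩)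
      · left; tauto
      · by_cases hT' : T ∈ ℳ
        · exact Or.inl ⟨Or.inr ⟨T, hT', hX⟩, fun h' => hc T hT' hX h'.1⟩
        · exact Or.inr ⟨T, ⟨hT.resolve_left hT', hT'⟩, hX⟩

/-- The one-sided overlay: a single bisection step can be pushed through a refinement. -/
theorem Refines.overlay_bisect {t : ℝ} {𝒯 𝒮 ℳ : TimeMesh} (h : Tiling t 𝒯) (hℳ : ℳ ⊆ 𝒯)
    (hr : Refines 𝒯 𝒮) :
    ∃ 𝒩 ⊆ 𝒮, 𝒩.card ≤ ℳ.card ∧ Refines (AdaptiveTime.bisect 𝒯 ℳ) (AdaptiveTime.bisect 𝒮 𝒩) := by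
  induction hr with
  | refl => exact ⟨ℳ, hℳ, le_rfl, .refl⟩
  | @tail 𝒮 𝒮' hr hs ih =>
    obtain ⟨ℳ', hℳ', rfl⟩ := hs
    obtain ⟨𝒩, h𝒩, hcard, hR⟩ := ih
    have hno := (Refines.tiling h hr).isNonoverlapping
    obtain ⟨h1, h2⟩ := hno.bisect_bisect hℳ' h𝒩
    obtain ⟨h3, h4⟩ := hno.bisect_bisect h𝒩 hℳ'
    refine ⟨𝒩 \ ℳ', h1, (Finset.card_le_card Finset.sdiff_subset).trans hcard, ?_⟩
    refine Relation.ReflTransGen.tail hR ⟨ℳ' \ 𝒩, h3, ?_⟩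
    rw [h2, h4, Finset.union_comm]

/-- Overlay estimate: two refinements `𝒮`, `𝒮'` of `𝒯` have a common refinement with at most
`#𝒮 + #𝒮' - #𝒯` elements. -/
theorem Refines.exists_overlay {t : ℝ} {𝒯 𝒮 𝒮' : TimeMesh} (h : Tiling t 𝒯)
    (hr : Refines 𝒯 𝒮) (hr' : Refines 𝒯 𝒮') :
    ∃ 𝒪 : TimeMesh, Refines 𝒮 𝒪 ∧ Refines 𝒮' 𝒪 ∧ 𝒪.card + 𝒯.card ≤ 𝒮.card + 𝒮'.card := by
  induction hr' with
  | refl => exact ⟨𝒮, .refl, hr, le_rfl⟩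
  | @tail 𝒮' 𝒮'' hr' hs ih =>
    obtain ⟨ℳ, hℳ, rfl⟩ := hs
    obtain ⟨𝒪, h1, h2, h3⟩ := ih
    have hT' := Refines.tiling h hr'
    obtain ⟨𝒩, h𝒩, hcard, hR⟩ := Refines.overlay_bisect hT' hℳ h2
    refine ⟨AdaptiveTime.bisect 𝒪 𝒩, h1.trans (Refines.bisect h𝒩), hR, ?_⟩
    rw [(Refines.tiling h (hr.trans h1)).isNonoverlapping.card_bisect h𝒩,
      hT'.isNonoverlapping.card_bisect hℳ]
    omega

/-! ### Ancestors in a coarser mesh -/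

/-- The element of `𝒯` that contains the interval `X` (a junk value if there is none). -/
noncomputable def ancestor (𝒯 : TimeMesh) (X : ℝ × ℝ) : ℝ × ℝ :=
  Classical.epsilon fun T => T ∈ 𝒯 ∧ T.1 ≤ X.1 ∧ X.2 ≤ T.2

theorem IsNonoverlapping.ancestor_eq {𝒯 : TimeMesh} (h : IsNonoverlapping 𝒯) {T X : ℝ × ℝ}
    (hT : T ∈ 𝒯) (hX : X.1 < X.2) (h1 : T.1 ≤ X.1) (h2 : X.2 ≤ T.2) : ancestor 𝒯 X = T := by
  obtain ⟨h3, h4, h5⟩ : ancestor 𝒯 X ∈ 𝒯 ∧ (ancestor 𝒯 X).1 ≤ X.1 ∧ X.2 ≤ (ancestor 𝒯 X).2 :=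
    Classical.epsilon_spec (p := fun T => T ∈ 𝒯 ∧ T.1 ≤ X.1 ∧ X.2 ≤ T.2) ⟨T, hT, h1, h2⟩
  exact h.eq_of_subset h3 hT hX h4 h5 h1 h2

theorem IsNonoverlapping.ancestor_self {𝒯 : TimeMesh} (h : IsNonoverlapping 𝒯) {T : ℝ × ℝ}
    (hT : T ∈ 𝒯) : ancestor 𝒯 T = T :=
  h.ancestor_eq hT (h.lt T hT) le_rfl le_rfl

theorem Refines.ancestor_spec {t : ℝ} {𝒯 𝒯' : TimeMesh} (h : Tiling t 𝒯) (hr : Refines 𝒯 𝒯') :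
    ∀ X ∈ 𝒯', ancestor 𝒯 X ∈ 𝒯 ∧ (ancestor 𝒯 X).1 ≤ X.1 ∧ X.2 ≤ (ancestor 𝒯 X).2 ∧
      (ancestor 𝒯 X = X ∨ X.2 - X.1 ≤ ((ancestor 𝒯 X).2 - (ancestor 𝒯 X).1) / 2) := by
  have hno := h.isNonoverlapping
  induction hr with
  | refl =>
    intro X hX
    rw [hno.ancestor_self hX]
    exact ⟨hX, le_rfl, le_rfl, Or.inl rfl⟩
  | @tail 𝒮 𝒯' hr hs ih =>
    obtain ⟨ℳ, hℳ, rfl⟩ := hs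
    intro X hX
    rcases mem_bisect.1 hX with ⟨hX, -⟩ | ⟨T, hT, hX⟩
    · exact ih X hX
    · obtain ⟨h1, h2, h3, h4⟩ := ih T (hℳ hT)
      have hlt := (Refines.tiling h hr).isNonoverlapping.lt T (hℳ hT)
      obtain ⟨g1, g2, g3, g4⟩ := children_spec hlt hX
      rw [hno.ancestor_eq h1 g2 (h2.trans g1) (g3.trans h3)]
      refine ⟨h1, h2.trans g1, g3.trans h3, Or.inr ?_⟩
      linarith

theorem Refines.ancestor_mem_iff {t : ℝ} {𝒯 𝒯' : TimeMesh} (h : Tiling t 𝒯)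
    (hr : Refines 𝒯 𝒯') {X : ℝ × ℝ} (hX : X ∈ 𝒯') : ancestor 𝒯 X ∈ 𝒯' ↔ X ∈ 𝒯 := by
  obtain ⟨h1, h2, h3, -⟩ := Refines.ancestor_spec h hr X hX
  have hno' := (Refines.tiling h hr).isNonoverlapping
  constructor
  · intro hm
    rw [hno'.eq_of_subset hX hm (hno'.lt X hX) le_rfl le_rfl h2 h3]
    exact h1
  · intro hm
    rwa [h.isNonoverlapping.ancestor_self hm]

theorem Refines.ancestor_eq_of_mem {t : ℝ} {𝒯 𝒯' : TimeMesh} (h : Tiling t 𝒯)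
    (hr : Refines 𝒯 𝒯') {X : ℝ × ℝ} (hX : X ∈ 𝒯') (hm : ancestor 𝒯 X ∈ 𝒯') :
    ancestor 𝒯 X = X :=
  h.isNonoverlapping.ancestor_self ((Refines.ancestor_mem_iff h hr hX).1 hm)

/-- Refinement preserves the integral of functions that are constant on the elements of the
coarse mesh. -/
theorem Refines.sum_ancestor {t : ℝ} {𝒯 𝒯' : TimeMesh} (h : Tiling t 𝒯) (hr : Refines 𝒯 𝒯')
    (φ : ℝ × ℝ → ℝ) :
    ∑ X ∈ 𝒯', (X.2 - X.1) * φ (ancestor 𝒯 X) = ∑ T ∈ 𝒯, (T.2 - T.1) * φ T := by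
  have hno := h.isNonoverlapping
  induction hr with
  | refl => exact Finset.sum_congr rfl fun X hX => by rw [hno.ancestor_self hX]
  | @tail 𝒮 𝒯' hr hs ih =>
    obtain ⟨ℳ, hℳ, rfl⟩ := hs
    have hS := Refines.tiling h hr
    rw [hS.isNonoverlapping.sum_bisect hℳ, ← ih, ← Finset.sum_sdiff hℳ]
    congr 1
    refine Finset.sum_congr rfl fun T hT => ?_
    obtain ⟨h1, h2, h3, -⟩ := Refines.ancestor_spec h hr T (hℳ hT)
    have hlt := hS.isNonoverlapping.lt T (hℳ hT)
    have hc : ∀ X ∈ children T, ancestor 𝒯 X = ancestor 𝒯 T := fun X hX => by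
      obtain ⟨g1, g2, g3, -⟩ := children_spec hlt hX
      exact hno.ancestor_eq h1 g2 (h2.trans g1) (g3.trans h3)
    rw [hc (T.1, mid T) (by simp [children]), hc (mid T, T.2) (by simp [children]), ← add_mul]
    simp

end AdaptiveTime

namespace AdaptiveTime

/-! ### Piecewise affine functions -/

section PiecewiseAffine

variable {E F : Type*} [NormedAddCommGroup E] [NormedSpace ℝ E]
  [NormedAddCommGroup F] [NormedSpace ℝ F]

/-- `v` is affine on every closed element of `𝒯`. -/
def PiecewiseAffine (𝒯 : TimeMesh) (v : ℝ → E) : Prop :=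
  ∀ T ∈ 𝒯, ∃ p q : E, ∀ t ∈ Icc T.1 T.2, v t = p + t • q

theorem slope_map (L : E →ₗ[ℝ] F) (v : ℝ → E) (a b : ℝ) :
    slope (fun t => L (v t)) a b = L (slope v a b) := by
  simp [slope_def_module]

theorem slope_eq_of_affine {v : ℝ → E} {p q : E} {a b : ℝ} (hab : a < b)
    (ha : v a = p + a • q) (hb : v b = p + b • q) : slope v a b = q := by
  have : b - a ≠ 0 := by linarith
  rw [slope_def_module, ha, hb, add_sub_add_left_eq_sub, ← sub_smul, smul_smul,
    inv_mul_cancel₀ this, one_smul]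

theorem PiecewiseAffine.map {𝒯 : TimeMesh} {v : ℝ → E} (h : PiecewiseAffine 𝒯 v)
    (L : E →ₗ[ℝ] F) : PiecewiseAffine 𝒯 fun t => L (v t) := by
  intro T hT
  obtain ⟨p, q, hpq⟩ := h T hT
  exact ⟨L p, L q, fun t ht => by simp [hpq t ht]⟩

theorem PiecewiseAffine.sub {𝒯 : TimeMesh} {v w : ℝ → E} (h : PiecewiseAffine 𝒯 v)
    (h' : PiecewiseAffine 𝒯 w) : PiecewiseAffine 𝒯 fun t => v t - w t := by
  intro T hT
  obtain ⟨p, q, hpq⟩ := h T hT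
  obtain ⟨p', q', hpq'⟩ := h' T hT
  refine ⟨p - p', q - q', fun t ht => ?_⟩
  simp only [hpq t ht, hpq' t ht, smul_sub]
  abel

theorem PiecewiseAffine.eq_of_mem {𝒯 : TimeMesh} {v : ℝ → E} (h : PiecewiseAffine 𝒯 v)
    {T : ℝ × ℝ} (hT : T ∈ 𝒯) (hlt : T.1 < T.2) {t : ℝ} (ht : t ∈ Icc T.1 T.2) :
    v t = v (mid T) + (t - mid T) • slope v T.1 T.2 := by
  obtain ⟨p, q, hpq⟩ := h T hT
  rw [slope_eq_of_affine hlt (hpq _ ⟨le_rfl, hlt.le⟩) (hpq _ ⟨hlt.le, le_rfl⟩), hpq t ht,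
    hpq (mid T) ⟨by unfold mid; linarith, by unfold mid; linarith⟩, sub_smul]
  abel

theorem PiecewiseAffine.slope_eq {𝒯 : TimeMesh} {v : ℝ → E} (h : PiecewiseAffine 𝒯 v)
    {T X : ℝ × ℝ} (hT : T ∈ 𝒯) (hX : X.1 < X.2) (h1 : T.1 ≤ X.1) (h2 : X.2 ≤ T.2) :
    slope v X.1 X.2 = slope v T.1 T.2 := by
  obtain ⟨p, q, hpq⟩ := h T hT
  rw [slope_eq_of_affine hX (hpq _ ⟨h1, by linarith⟩) (hpq _ ⟨by linarith, h2⟩),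
    slope_eq_of_affine (h1.trans_lt (hX.trans_le h2)) (hpq _ ⟨le_rfl, by linarith⟩)
      (hpq _ ⟨by linarith, le_rfl⟩)]

/-- The mean of the two end point values of `v` on `T`. -/
noncomputable def endMean (v : ℝ → E) (T : ℝ × ℝ) : E := (1 / 2 : ℝ) • (v T.1 + v T.2)

theorem PiecewiseAffine.endMean_eq {𝒯 : TimeMesh} {v : ℝ → E} (h : PiecewiseAffine 𝒯 v)
    {T : ℝ × ℝ} (hT : T ∈ 𝒯) (hlt : T.1 < T.2) : endMean v T = v (mid T) := by
  obtain ⟨p, q, hpq⟩ := h T hT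
  rw [endMean, hpq _ ⟨le_rfl, hlt.le⟩, hpq _ ⟨hlt.le, le_rfl⟩,
    hpq (mid T) ⟨by unfold mid; linarith, by unfold mid; linarith⟩]
  unfold mid
  module

theorem PiecewiseAffine.deriv_eq {𝒯 : TimeMesh} {v : ℝ → E} (h : PiecewiseAffine 𝒯 v)
    {T : ℝ × ℝ} (hT : T ∈ 𝒯) {t : ℝ} (ht : t ∈ Ioo T.1 T.2) :
    deriv v t = slope v T.1 T.2 := by
  obtain ⟨p, q, hpq⟩ := h T hT
  have hlt := ht.1.trans ht.2
  rw [slope_eq_of_affine hlt (hpq _ ⟨le_rfl, hlt.le⟩) (hpq _ ⟨hlt.le, le_rfl⟩)]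
  have h1 : HasDerivAt (fun t : ℝ => p + t • q) q t := by
    simpa using ((hasDerivAt_id t).smul_const q).const_add p
  have h2 : v =ᶠ[nhds t] fun t => p + t • q :=
    Filter.eventually_of_mem (Icc_mem_nhds ht.1 ht.2) hpq
  exact (h1.congr_of_eventuallyEq h2).deriv

theorem PiecewiseAffine.of_refines {t : ℝ} {𝒯 𝒯' : TimeMesh} (h𝒯 : Tiling t 𝒯)
    (hr : Refines 𝒯 𝒯') {v : ℝ → E} (h : PiecewiseAffine 𝒯 v) : PiecewiseAffine 𝒯' v := by
  intro X hX
  obtain ⟨h1, h2, h3, -⟩ := Refines.ancestor_spec h𝒯 hr X hX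
  obtain ⟨p, q, hpq⟩ := h _ h1
  exact ⟨p, q, fun t ht => hpq t ⟨h2.trans ht.1, ht.2.trans h3⟩⟩

theorem PiecewiseAffine.exists_lipschitz {t : ℝ} {𝒯 : TimeMesh} (h𝒯 : Tiling t 𝒯) {v : ℝ → E}
    (h : PiecewiseAffine 𝒯 v) : ∃ K : NNReal, LipschitzOnWith K v (Icc 0 t) := by
  induction h𝒯 with
  | empty =>
    refine ⟨0, fun x hx y hy => ?_⟩
    obtain rfl : x = 0 := le_antisymm hx.2 hx.1
    obtain rfl : y = 0 := le_antisymm hy.2 hy.1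
    simp
  | @snoc a b 𝒯 h𝒯 hab ih =>
    obtain ⟨K, hK⟩ := ih fun T hT => h T (Finset.mem_insert_of_mem hT)
    obtain ⟨p, q, hpq⟩ := h (a, b) (Finset.mem_insert_self _ _)
    have ha := h𝒯.bounds.1
    -- Both pieces share the Lipschitz constant `K + ‖q‖`; an interval across `a` is split at `a`.
    have key : ∀ x ∈ Icc 0 b, ∀ y ∈ Icc 0 b, x ≤ y → ‖v y - v x‖ ≤ (K + ‖q‖₊ : NNReal) * (y - x) := by
      have h1 : ∀ x ∈ Icc 0 a, ∀ y ∈ Icc 0 a, x ≤ y →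
          ‖v y - v x‖ ≤ (K + ‖q‖₊ : NNReal) * (y - x) := by
        intro x hx y hy hxy
        have := hK.norm_sub_le hy hx
        rw [Real.norm_of_nonneg (by linarith)] at this
        push_cast
        nlinarith [norm_nonneg q]
      have h2 : ∀ x ∈ Icc a b, ∀ y ∈ Icc a b, x ≤ y →
          ‖v y - v x‖ ≤ (K + ‖q‖₊ : NNReal) * (y - x) := by
        intro x hx y hy hxy
        rw [hpq x hx, hpq y hy, add_sub_add_left_eq_sub, ← sub_smul, norm_smul,
          Real.norm_of_nonneg (by linarith)]
        push_cast
        nlinarith [K.2, show (K : ℝ) = K.1 from rfl, mul_nonneg K.2 (sub_nonneg.2 hxy)]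
      intro x hx y hy hxy
      rcases le_total y a with hya | hya
      · exact h1 x ⟨hx.1, hxy.trans hya⟩ y ⟨hy.1, hya⟩ hxy
      · rcases le_total a x with hxa | hxa
        · exact h2 x ⟨hxa, hx.2⟩ y ⟨hya, hy.2⟩ hxy
        · have e1 := h1 x ⟨hx.1, hxa⟩ a ⟨ha, le_rfl⟩ hxa
          have e2 := h2 a ⟨le_rfl, hab.le⟩ y ⟨hya, hy.2⟩ hya
          have e3 := norm_sub_le_norm_sub_add_norm_sub (v y) (v a) (v x)
          linarith
    refine ⟨K + ‖q‖₊, LipschitzOnWith.of_dist_le_mul fun x hx y hy => ?_⟩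
    rcases le_total x y with hxy | hxy
    · rw [dist_comm, dist_comm x, dist_eq_norm, Real.dist_eq, abs_of_nonneg (by linarith)]
      exact key x hx y hy hxy
    · rw [dist_eq_norm, Real.dist_eq, abs_of_nonneg (by linarith)]
      exact key y hy x hx hxy

end PiecewiseAffine

/-! ### Integrals of piecewise constant functions -/

theorem integral_eq_of_const_Ioo {a b γ : ℝ} (hab : a ≤ b) {g : ℝ → ℝ}
    (hg : ∀ s ∈ Ioo a b, g s = γ) :
    IntervalIntegrable g volume a b ∧ ∫ s in a..b, g s = (b - a) * γ := by
  constructor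
  · refine (intervalIntegrable_const (c := γ)).congr_uIoo ?_
    rw [uIoo_of_le hab]
    exact fun s hs => (hg s hs).symm
  · rw [intervalIntegral.integral_congr_Ioo_of_le hab hg]
    simp

theorem Tiling.integral_eq_sum {t : ℝ} {𝒯 : TimeMesh} (h : Tiling t 𝒯) {g : ℝ → ℝ}
    {γ : ℝ × ℝ → ℝ} (hg : ∀ T ∈ 𝒯, ∀ s ∈ Ioo T.1 T.2, g s = γ T) :
    IntervalIntegrable g volume 0 t ∧ ∫ s in 0..t, g s = ∑ T ∈ 𝒯, (T.2 - T.1) * γ T := by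
  induction h with
  | empty => simp
  | snoc h hab ih =>
    obtain ⟨h1, h2⟩ := ih fun T hT => hg T (Finset.mem_insert_of_mem hT)
    obtain ⟨h3, h4⟩ := integral_eq_of_const_Ioo hab.le (hg _ (Finset.mem_insert_self _ _))
    refine ⟨h1.trans h3, ?_⟩
    rw [← intervalIntegral.integral_add_adjacent_intervals h1 h3, Finset.sum_insert (h.notMem hab),
      h2, h4, add_comm]

theorem Tiling.integral_le_sum {t : ℝ} {𝒯 : TimeMesh} (h : Tiling t 𝒯) {g : ℝ → ℝ}
    (hc : ContinuousOn g (Icc 0 t)) {γ : ℝ × ℝ → ℝ}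
    (hg : ∀ T ∈ 𝒯, ∀ s ∈ Ioo T.1 T.2, g s ≤ γ T) :
    ∫ s in 0..t, g s ≤ ∑ T ∈ 𝒯, (T.2 - T.1) * γ T := by
  induction h with
  | empty => simp
  | @snoc a b 𝒯 h hab ih =>
    have ha := h.bounds.1
    have hc1 : ContinuousOn g (Icc 0 a) := hc.mono (Icc_subset_Icc_right hab.le)
    have hc2 : ContinuousOn g (Icc a b) := hc.mono (Icc_subset_Icc_left ha)
    have h1 := hc1.intervalIntegrable_of_Icc (μ := volume) ha
    have h2 := hc2.intervalIntegrable_of_Icc (μ := volume) hab.le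
    have h3 := ih hc1 fun T hT => hg T (Finset.mem_insert_of_mem hT)
    have h4 := intervalIntegral.integral_mono_on_of_le_Ioo hab.le h2
      (intervalIntegrable_const (c := γ (a, b))) (hg _ (Finset.mem_insert_self _ _))
    rw [← intervalIntegral.integral_add_adjacent_intervals h1 h2, Finset.sum_insert (h.notMem hab),
      add_comm]
    refine add_le_add ?_ h3
    simpa using h4

namespace ParabolicProblem

variable {V H : Type*} [NormedAddCommGroup V] [InnerProductSpace ℝ V] [FiniteDimensional ℝ V]
  [NormedAddCommGroup H] [InnerProductSpace ℝ H] {tEnd : ℝ} (P : ParabolicProblem V H tEnd)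

/-! ### Solvability of the Crank–Nicolson scheme -/

theorem J_self_nonneg (v : V) : 0 ≤ P.J v v := by
  rw [J_apply]; exact real_inner_self_nonneg

theorem eq_zero_of_step {c τ : ℝ} (hc : 0 < c) (hτ : 0 < τ)
    (hA : ∀ v : V, c * ‖v‖ ^ 2 ≤ P.A v v) {q : V} (h : P.J q + τ • P.A q = 0) : q = 0 := by
  have h1 : P.J q q + τ * P.A q q = 0 := by simpa using congrArg (fun g => g q) h
  have h2 := P.J_self_nonneg q
  have h3 : P.A q q ≤ 0 := by
    by_contra! h4
    nlinarith [mul_pos hτ h4]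
  have h4 : ‖q‖ ^ 2 ≤ 0 := by
    have := hA q
    by_contra! h5
    nlinarith [mul_pos hc h5]
  exact norm_eq_zero.1 (pow_eq_zero_iff (two_ne_zero)|>.1 (le_antisymm h4 (sq_nonneg _)))

theorem exists_step {c τ : ℝ} (hc : 0 < c) (hτ : 0 < τ)
    (hA : ∀ v : V, c * ‖v‖ ^ 2 ≤ P.A v v) (x : V) (F : StrongDual ℝ V) :
    ∃ q : V, P.J q + P.A (x + τ • q) = F := by
  let L : V →ₗ[ℝ] StrongDual ℝ V := P.J + τ • P.A.toLinearMap
  have hinj : Function.Injective L := by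
    rw [← LinearMap.ker_eq_bot, LinearMap.ker_eq_bot']
    exact fun q hq => P.eq_zero_of_step hc hτ hA (by simpa [L] using hq)
  have hfin : Module.finrank ℝ V = Module.finrank ℝ (StrongDual ℝ V) := by
    rw [← (LinearMap.toContinuousLinearMap : (V →ₗ[ℝ] ℝ) ≃ₗ[ℝ] (V →L[ℝ] ℝ)).finrank_eq]
    exact (Subspace.dual_finrank_eq (K := ℝ) (V := V)).symm
  obtain ⟨q, hq⟩ := (LinearMap.injective_iff_surjective_of_finrank_eq_finrank hfin).1 hinj
    (F - P.A x)
  refine ⟨q, ?_⟩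
  have hq' : P.J q + τ • P.A q = F - P.A x := by simpa [L] using hq
  rw [map_add, map_smul, add_left_comm, hq']
  abel

theorem exists_crankNicolson {c : ℝ} (hc : 0 < c) (hA : ∀ v : V, c * ‖v‖ ^ 2 ≤ P.A v v) {t : ℝ}
    {𝒯 : TimeMesh} (h : Tiling t 𝒯) :
    ∃ v : ℝ → V, P.ι (v 0) = P.u₀ ∧ PiecewiseAffine 𝒯 v ∧
      ∀ T ∈ 𝒯, (T.2 - T.1)⁻¹ • P.J (v T.2 - v T.1) + P.A (v (mid T)) = P.f (mid T) := by
  induction h with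
  | empty => exact ⟨fun _ => P.ι.symm P.u₀, by simp [PiecewiseAffine]⟩
  | @snoc a b 𝒯 h hab ih =>
    obtain ⟨v, h0, haff, hstep⟩ := ih
    obtain ⟨q, hq⟩ := P.exists_step hc (half_pos (sub_pos.2 hab)) hA (v a) (P.f (mid (a, b)))
    have ha := h.bounds.1
    have hold : ∀ t ≤ a, (if t ≤ a then v t else v a + (t - a) • q) = v t :=
      fun t ht => if_pos ht
    have hnew : ∀ t, a ≤ t → (if t ≤ a then v t else v a + (t - a) • q) = v a + (t - a) • q := by
      intro t ht
      split_ifs with h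
      · obtain rfl := le_antisymm h ht
        simp
      · rfl
    refine ⟨fun t => if t ≤ a then v t else v a + (t - a) • q, ?_, ?_, ?_⟩
    · simpa [ha] using h0
    · intro T hT
      rcases Finset.mem_insert.1 hT with rfl | hT
      · exact ⟨v a - a • q, q, fun t ht => (hnew t ht.1).trans (by rw [sub_smul]; abel)⟩
      · obtain ⟨p, q, hpq⟩ := haff T hT
        exact ⟨p, q, fun t ht => (hold t (ht.2.trans (h.bounds.2 T hT).2.2)).trans (hpq t ht)⟩
    · intro T hT
      rcases Finset.mem_insert.1 hT with rfl | hT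
      · have hm : mid (a, b) - a = (b - a) / 2 := mid_sub_fst (a, b)
        have hne : b - a ≠ 0 := by linarith
        have hnm := hnew (mid (a, b)) (by linarith)
        rw [hm] at hnm
        simp only [hnew a le_rfl, hnew b hab.le, hm]
        rw [hnm]
        rw [← hq]
        simp [smul_smul, inv_mul_cancel₀ hne]
      · obtain ⟨-, h1, h2⟩ := h.bounds.2 T hT
        simp only [hold T.1 (by linarith), hold T.2 h2, hold (mid T) (by unfold mid; linarith)]
        exact hstep T hT

theorem crankNicolson_unique {c : ℝ} (hc : 0 < c) (hA : ∀ v : V, c * ‖v‖ ^ 2 ≤ P.A v v) {t : ℝ}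
    {𝒯 : TimeMesh} (h : Tiling t 𝒯) {v w : ℝ → V} (h0 : v 0 = w 0) (hv : PiecewiseAffine 𝒯 v)
    (hw : PiecewiseAffine 𝒯 w)
    (hstep : ∀ T ∈ 𝒯, (T.2 - T.1)⁻¹ • P.J (v T.2 - v T.1) + P.A (v (mid T)) =
      (T.2 - T.1)⁻¹ • P.J (w T.2 - w T.1) + P.A (w (mid T))) : EqOn v w (Icc 0 t) := by
  induction h with
  | empty =>
    intro x hx
    rwa [le_antisymm hx.2 hx.1]
  | @snoc a b 𝒯 h hab ih =>
    have hin := Finset.mem_insert_self (a, b) 𝒯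
    have ih' := ih (fun T hT => hv T (Finset.mem_insert_of_mem hT))
      (fun T hT => hw T (Finset.mem_insert_of_mem hT))
      fun T hT => hstep T (Finset.mem_insert_of_mem hT)
    have hva : v a = w a := ih' ⟨h.bounds.1, le_rfl⟩
    have hs := hstep _ hin
    have hd := hv.sub hw
    set d : ℝ → V := fun t => v t - w t with hd'
    have hda : d a = 0 := sub_eq_zero.2 hva
    have haff : ∀ t ∈ Icc a b, d t = (t - a) • slope d a b := by
      intro t ht
      have e1 := hd.eq_of_mem hin hab ht
      have e2 := hd.eq_of_mem hin hab (t := a) ⟨le_rfl, hab.le⟩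
      rw [hda] at e2
      rw [e1, show t - mid (a, b) = (t - a) + (a - mid (a, b)) by ring, add_smul, add_left_comm,
        ← e2, add_zero]
    have hz : P.J (slope d a b) + ((b - a) / 2) • P.A (slope d a b) = 0 := by
      have hmid : d (mid (a, b)) = ((b - a) / 2) • slope d a b := by
        rw [haff _ ⟨by simp only [mid]; linarith, by simp only [mid]; linarith⟩]
        congr 1
        exact mid_sub_fst (a, b)
      rw [← map_smul, ← hmid, slope_def_module, map_smul, hd']
      simp only [map_sub, smul_sub] at hs ⊢
      rw [← sub_eq_zero] at hs
      rw [← hs]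
      abel
    have hq := P.eq_zero_of_step hc (half_pos (sub_pos.2 hab)) hA hz
    intro x hx
    rcases le_total x a with hxa | hxa
    · exact ih' ⟨hx.1, hxa⟩
    · exact sub_eq_zero.1 ((haff x ⟨hxa, hx.2⟩).trans (by rw [hq, smul_zero]))

theorem memX_of_piecewiseAffine {𝒯 : TimeMesh} (h : Tiling tEnd 𝒯) {v : ℝ → V}
    (hv : PiecewiseAffine 𝒯 v) : P.MemX v := by
  obtain ⟨K, hK⟩ := hv.exists_lipschitz h
  obtain ⟨K', hK'⟩ := (hv.map P.J).exists_lipschitz h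
  refine ⟨?_, ?_, ?_⟩
  · obtain ⟨B, hB⟩ := isCompact_Icc.exists_bound_of_continuousOn hK.continuousOn
    exact MemLp.of_bound (hK.continuousOn.aestronglyMeasurable measurableSet_Icc) B
      ((ae_restrict_iff' measurableSet_Icc).2 (.of_forall hB))
  · apply LipschitzOnWith.absolutelyContinuousOnInterval (K := K')
    rwa [uIcc_of_le h.bounds.1]
  · refine MemLp.of_bound (aestronglyMeasurable_deriv _ _) K' ?_
    rw [← restrict_Ioo_eq_restrict_Icc]
    exact (ae_restrict_iff' measurableSet_Ioo).2 (.of_forall fun t ht =>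
      norm_deriv_le_of_lipschitzOn (Icc_mem_nhds ht.1 ht.2) hK')

theorem isCrankNicolson_cn {c : ℝ} (hc : 0 < c) (hA : ∀ v : V, c * ‖v‖ ^ 2 ≤ P.A v v)
    {𝒯 : TimeMesh} (h : Tiling tEnd 𝒯) : P.IsCrankNicolson 𝒯 (P.cn 𝒯) := by
  obtain ⟨v, h0, haff, hstep⟩ := P.exists_crankNicolson hc hA h
  exact Classical.epsilon_spec (p := P.IsCrankNicolson 𝒯)
    ⟨v, ⟨P.memX_of_piecewiseAffine h haff, haff⟩, h0, hstep⟩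

theorem IsCrankNicolson.eqOn {c : ℝ} (hc : 0 < c) (hA : ∀ v : V, c * ‖v‖ ^ 2 ≤ P.A v v)
    {𝒯 : TimeMesh} (h : Tiling tEnd 𝒯) {v w : ℝ → V} (hv : P.IsCrankNicolson 𝒯 v)
    (hw : P.IsCrankNicolson 𝒯 w) : EqOn v w (Icc 0 tEnd) :=
  P.crankNicolson_unique hc hA h (P.ι.injective (hv.initial.trans hw.initial.symm))
    hv.mem.affine hw.mem.affine fun T hT => (hv.step T hT).trans (hw.step T hT).symm

/-! ### The norm of `𝒳` and the energy estimate -/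

theorem integral_deriv_sq {𝒯 : TimeMesh} (h : Tiling tEnd 𝒯) {v : ℝ → V}
    (hv : PiecewiseAffine 𝒯 v) :
    ∫ t in (0 : ℝ)..tEnd, ‖deriv (fun τ => P.J (v τ)) t‖ ^ 2 =
      ∑ T ∈ 𝒯, (T.2 - T.1) * ‖P.J (slope v T.1 T.2)‖ ^ 2 :=
  (h.integral_eq_sum fun T hT s hs => by rw [(hv.map P.J).deriv_eq hT hs, slope_map]).2

theorem normX_sq (h : 0 ≤ tEnd) (v : ℝ → V) :
    P.normX v ^ 2 = (∫ t in (0 : ℝ)..tEnd, ‖v t‖ ^ 2) +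
      ∫ t in (0 : ℝ)..tEnd, ‖deriv (fun τ => P.J (v τ)) t‖ ^ 2 :=
  Real.sq_sqrt (add_nonneg (intervalIntegral.integral_nonneg h fun _ _ => sq_nonneg _)
    (intervalIntegral.integral_nonneg h fun _ _ => sq_nonneg _))

theorem sum_slope_le_normX {𝒯 : TimeMesh} (h : Tiling tEnd 𝒯) {v : ℝ → V}
    (hv : PiecewiseAffine 𝒯 v) :
    ∑ T ∈ 𝒯, (T.2 - T.1) * ‖P.J (slope v T.1 T.2)‖ ^ 2 ≤ P.normX v ^ 2 := by
  rw [P.normX_sq h.bounds.1, P.integral_deriv_sq h hv]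
  exact le_add_of_nonneg_left
    (intervalIntegral.integral_nonneg h.bounds.1 fun _ _ => sq_nonneg _)

theorem normX_sq_le {𝒯 : TimeMesh} (h : Tiling tEnd 𝒯) {v : ℝ → V}
    (hv : PiecewiseAffine 𝒯 v) :
    P.normX v ^ 2 ≤ ∑ T ∈ 𝒯, (T.2 - T.1) * (2 * ‖endMean v T‖ ^ 2 +
      (T.2 - T.1) ^ 2 / 2 * ‖slope v T.1 T.2‖ ^ 2 + ‖P.J (slope v T.1 T.2)‖ ^ 2) := by
  obtain ⟨K, hK⟩ := hv.exists_lipschitz h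
  rw [P.normX_sq h.bounds.1, P.integral_deriv_sq h hv]
  simp only [mul_add _ (_ + _) (‖P.J _‖ ^ 2)]
  rw [Finset.sum_add_distrib]
  refine add_le_add_left (h.integral_le_sum (hK.continuousOn.norm.pow 2) fun T hT s hs => ?_) _
  have hlt := hs.1.trans hs.2
  have h1 : |s - mid T| ≤ (T.2 - T.1) / 2 := by
    unfold mid
    rw [abs_le]
    constructor <;> linarith [hs.1, hs.2]
  have h2 : ‖v s‖ ≤ ‖endMean v T‖ + (T.2 - T.1) / 2 * ‖slope v T.1 T.2‖ := by
    rw [hv.eq_of_mem hT hlt ⟨hs.1.le, hs.2.le⟩, hv.endMean_eq hT hlt]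
    refine (norm_add_le _ _).trans ?_
    rw [norm_smul, Real.norm_eq_abs]
    gcongr
  have h3 := pow_le_pow_left₀ (norm_nonneg _) h2 2
  change ‖v s‖ ^ 2 ≤ _
  nlinarith [sq_nonneg (‖endMean v T‖ - (T.2 - T.1) / 2 * ‖slope v T.1 T.2‖)]

/-- The residual of the Crank–Nicolson scheme on `T` for the end point values of `v`. -/
noncomputable def cnResidual (v : ℝ → V) (T : ℝ × ℝ) : StrongDual ℝ V :=
  P.J (slope v T.1 T.2) + P.A (endMean v T)

/-- The discrete energy identity: testing the difference quotient with the mean of the end point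
values telescopes. -/
theorem sum_energy {t : ℝ} {𝒯 : TimeMesh} (h : Tiling t 𝒯) {v : ℝ → V} (h0 : v 0 = 0) :
    ∑ T ∈ 𝒯, (T.2 - T.1) * P.J (slope v T.1 T.2) (endMean v T) = P.J (v t) (v t) / 2 := by
  induction h with
  | empty => simp [h0]
  | @snoc a b 𝒯 h hab ih =>
    rw [Finset.sum_insert (h.notMem hab), ih]
    have hne : b - a ≠ 0 := by linarith
    have hsymm : P.J (v a) (v b) = P.J (v b) (v a) := by
      rw [J_apply, J_apply, real_inner_comm]
    simp only [slope_def_module, endMean, map_smul, map_sub, map_add,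
      smul_apply, sub_apply, smul_eq_mul, hsymm]
    field_simp
    ring

/-- Energy stability of the Crank–Nicolson scheme with zero initial value. -/
theorem energy_estimate {c C : ℝ} (hc : 0 < c) (hA : ∀ v : V, c * ‖v‖ ^ 2 ≤ P.A v v)
    (hAC : ∀ v : V, ‖P.A v‖ ≤ C * ‖v‖) {t : ℝ} {𝒯 : TimeMesh} (h : Tiling t 𝒯) {v : ℝ → V}
    (h0 : v 0 = 0) :
    c ^ 2 * ∑ T ∈ 𝒯, (T.2 - T.1) * ‖endMean v T‖ ^ 2 ≤
        ∑ T ∈ 𝒯, (T.2 - T.1) * ‖P.cnResidual v T‖ ^ 2 ∧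
      c ^ 2 * ∑ T ∈ 𝒯, (T.2 - T.1) * ‖P.J (slope v T.1 T.2)‖ ^ 2 ≤
        2 * (c ^ 2 + C ^ 2) * ∑ T ∈ 𝒯, (T.2 - T.1) * ‖P.cnResidual v T‖ ^ 2 := by
  have hmean : c ^ 2 * ∑ T ∈ 𝒯, (T.2 - T.1) * ‖endMean v T‖ ^ 2 ≤
      ∑ T ∈ 𝒯, (T.2 - T.1) * ‖P.cnResidual v T‖ ^ 2 := by
    have hpos : 0 ≤ ∑ T ∈ 𝒯, (T.2 - T.1) * P.J (slope v T.1 T.2) (endMean v T) := by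
      rw [P.sum_energy h h0]
      linarith [P.J_self_nonneg (v t)]
    have hsum : ∑ T ∈ 𝒯, (c ^ 2 * ((T.2 - T.1) * ‖endMean v T‖ ^ 2) +
        2 * c * ((T.2 - T.1) * P.J (slope v T.1 T.2) (endMean v T))) ≤
        ∑ T ∈ 𝒯, (T.2 - T.1) * ‖P.cnResidual v T‖ ^ 2 := by
      refine Finset.sum_le_sum fun T hT => ?_
      have hlt := (h.bounds.2 T hT).2.1
      set m := endMean v T
      have h1 : P.J (slope v T.1 T.2) m + P.A m m ≤ ‖P.cnResidual v T‖ * ‖m‖ :=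
        (le_abs_self _).trans ((P.cnResidual v T).le_opNorm m)
      have h2 := hA m
      have h3 : c ^ 2 * ‖m‖ ^ 2 + 2 * c * P.J (slope v T.1 T.2) m ≤ ‖P.cnResidual v T‖ ^ 2 := by
        nlinarith [sq_nonneg (‖P.cnResidual v T‖ - c * ‖m‖)]
      nlinarith
    rw [Finset.sum_add_distrib, ← Finset.mul_sum, ← Finset.mul_sum] at hsum
    nlinarith
  refine ⟨hmean, ?_⟩
  have hs : ∑ T ∈ 𝒯, (T.2 - T.1) * ‖P.J (slope v T.1 T.2)‖ ^ 2 ≤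
      ∑ T ∈ 𝒯, (2 * ((T.2 - T.1) * ‖P.cnResidual v T‖ ^ 2) +
        2 * C ^ 2 * ((T.2 - T.1) * ‖endMean v T‖ ^ 2)) := by
    refine Finset.sum_le_sum fun T hT => ?_
    have hlt := (h.bounds.2 T hT).2.1
    have h1 : ‖P.J (slope v T.1 T.2)‖ ≤ ‖P.cnResidual v T‖ + C * ‖endMean v T‖ := by
      have : P.J (slope v T.1 T.2) = P.cnResidual v T - P.A (endMean v T) := by
        rw [cnResidual]; abel
      rw [this]
      exact (norm_sub_le _ _).trans (by gcongr; exact hAC _)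
    have h2 := pow_le_pow_left₀ (norm_nonneg _) h1 2
    have h3 : ‖P.J (slope v T.1 T.2)‖ ^ 2 ≤
        2 * ‖P.cnResidual v T‖ ^ 2 + 2 * C ^ 2 * ‖endMean v T‖ ^ 2 := by
      nlinarith [sq_nonneg (‖P.cnResidual v T‖ - C * ‖endMean v T‖)]
    nlinarith
  rw [Finset.sum_add_distrib, ← Finset.mul_sum, ← Finset.mul_sum] at hs
  nlinarith [sq_nonneg C, sq_nonneg c, mul_le_mul_of_nonneg_left hs (sq_nonneg c),
    mul_le_mul_of_nonneg_left hmean (sq_nonneg C)]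

end ParabolicProblem

end AdaptiveTime

namespace AdaptiveTime

namespace ParabolicProblem

variable {V H : Type*} [NormedAddCommGroup V] [InnerProductSpace ℝ V] [FiniteDimensional ℝ V]
  [NormedAddCommGroup H] [InnerProductSpace ℝ H] {tEnd : ℝ} (P : ParabolicProblem V H tEnd)

/-! ### The residual representation of the estimator -/

/-- The standing assumptions in the form in which they are used: the inverse inequality and the
CFL condition enter only through `‖v‖ ≤ K ‖v‖_{V*}`. -/
structure IsStable (𝒯₀ : TimeMesh) (c C K : ℝ) : Prop where
  tiling : Tiling tEnd 𝒯₀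
  c_pos : 0 < c
  C_nonneg : 0 ≤ C
  K_nonneg : 0 ≤ K
  coercive : ∀ v : V, c * ‖v‖ ^ 2 ≤ P.A v v
  bounded : ∀ v : V, ‖P.A v‖ ≤ C * ‖v‖
  inverse : ∀ v : V, ‖v‖ ≤ K * ‖P.J v‖
  f_affine : ∀ T ∈ 𝒯₀, ∃ p q : StrongDual ℝ V, ∀ t ∈ Ioo T.1 T.2, P.f t = p + t • q

/-- The CFL condition bounds `h ^ (-2s)` by the reciprocal of the length of one fixed element of
the initial mesh. -/
theorem IsAdmissible.isStable {𝒯₀ : TimeMesh} {c C Cinv κ h s : ℝ}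
    (hP : P.IsAdmissible 𝒯₀ c C Cinv κ h s) (ht : Tiling tEnd 𝒯₀) (hc : 0 < c) (hC : 0 < C)
    (hCinv : 0 < Cinv) (hκ : 0 < κ) (hh : 0 < h) {T₀ : ℝ × ℝ} (hT₀ : T₀ ∈ 𝒯₀) :
    P.IsStable 𝒯₀ c C (Cinv / (κ * (T₀.2 - T₀.1))) := by
  have hlt : 0 < T₀.2 - T₀.1 := sub_pos.2 (ht.bounds.2 T₀ hT₀).2.1
  refine ⟨ht, hc, hC.le, by positivity, hP.coercive, hP.bounded, fun v => ?_, hP.f_affine⟩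
  refine (hP.inverse v).trans (mul_le_mul_of_nonneg_right ?_ (norm_nonneg _))
  rw [div_eq_mul_inv, Real.rpow_neg hh.le]
  refine mul_le_mul_of_nonneg_left (inv_anti₀ (by positivity) ?_) hCinv.le
  exact (le_div_iff₀ hlt).1 (hP.cfl T₀ hT₀)

/-- The estimator density: the constant value of `∂ₜ f - ∂ₜ 𝔸 u_𝒯` in the interior of `T ∈ 𝒯`. The
midpoint is used because `f` may jump at the end points of `T`. -/
noncomputable def oscSlope (𝒯 : TimeMesh) (T : ℝ × ℝ) : StrongDual ℝ V :=
  deriv P.f (mid T) - P.A (slope (P.cn 𝒯) T.1 T.2)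

variable {P} {𝒯₀ : TimeMesh} {c C K : ℝ}

theorem IsStable.isCrankNicolson (hP : P.IsStable 𝒯₀ c C K) {𝒯 : TimeMesh}
    (hr : Refines 𝒯₀ 𝒯) : P.IsCrankNicolson 𝒯 (P.cn 𝒯) :=
  P.isCrankNicolson_cn hP.c_pos hP.coercive (hr.tiling hP.tiling)

theorem IsStable.affine (hP : P.IsStable 𝒯₀ c C K) {𝒯 : TimeMesh} (hr : Refines 𝒯₀ 𝒯) :
    PiecewiseAffine 𝒯 (P.cn 𝒯) := (hP.isCrankNicolson hr).mem.affine

theorem IsStable.length_bounds (hP : P.IsStable 𝒯₀ c C K) {𝒯 : TimeMesh} (hr : Refines 𝒯₀ 𝒯)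
    {T : ℝ × ℝ} (hT : T ∈ 𝒯) : 0 < T.2 - T.1 ∧ T.2 - T.1 ≤ tEnd := by
  have := (hr.tiling hP.tiling).bounds.2 T hT
  constructor <;> linarith

theorem IsStable.load_affine (hP : P.IsStable 𝒯₀ c C K) {𝒯 : TimeMesh} (hr : Refines 𝒯₀ 𝒯)
    {T : ℝ × ℝ} (hT : T ∈ 𝒯) {t : ℝ} (ht : t ∈ Ioo T.1 T.2) :
    P.f t = P.f (mid T) + (t - mid T) • deriv P.f (mid T) ∧
      deriv P.f t = deriv P.f (mid T) := by
  obtain ⟨h1, h2, h3, -⟩ := Refines.ancestor_spec hP.tiling hr T hT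
  obtain ⟨p, q, hpq⟩ := hP.f_affine _ h1
  have hd : ∀ x ∈ Ioo T.1 T.2, deriv P.f x = q := by
    intro x hx
    have h4 : HasDerivAt (fun t : ℝ => p + t • q) q x := by
      simpa using ((hasDerivAt_id x).smul_const q).const_add p
    have h5 : P.f =ᶠ[nhds x] fun t => p + t • q :=
      Filter.eventually_of_mem (Ioo_mem_nhds (h2.trans_lt hx.1) (hx.2.trans_le h3)) hpq
    exact (h4.congr_of_eventuallyEq h5).deriv
  have hlt := ht.1.trans ht.2
  have hm : mid T ∈ Ioo T.1 T.2 := ⟨by unfold mid; linarith, by unfold mid; linarith⟩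
  refine ⟨?_, (hd t ht).trans (hd _ hm).symm⟩
  rw [hd _ hm, hpq t ⟨h2.trans_lt ht.1, ht.2.trans_le h3⟩,
    hpq _ ⟨h2.trans_lt hm.1, hm.2.trans_le h3⟩]
  module

theorem IsStable.etaT_eq (hP : P.IsStable 𝒯₀ c C K) {𝒯 : TimeMesh} (hr : Refines 𝒯₀ 𝒯)
    {T : ℝ × ℝ} (hT : T ∈ 𝒯) :
    P.etaT 𝒯 T = (T.2 - T.1) * Real.sqrt (T.2 - T.1) * ‖P.oscSlope 𝒯 T‖ := by
  have hlt := (hP.length_bounds hr hT).1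
  have hA := (hP.affine hr).map P.A.toLinearMap
  have hI : ∫ t in T.1..T.2, ‖deriv P.f t - deriv (fun τ => P.A (P.cn 𝒯 τ)) t‖ ^ 2 =
      (T.2 - T.1) * ‖P.oscSlope 𝒯 T‖ ^ 2 := by
    refine (integral_eq_of_const_Ioo (by linarith) fun t ht => ?_).2
    have h1 : deriv (fun τ => P.A (P.cn 𝒯 τ)) t = P.A (slope (P.cn 𝒯) T.1 T.2) :=
      (hA.deriv_eq hT ht).trans (slope_map P.A.toLinearMap _ _ _)
    rw [h1, (hP.load_affine hr hT ht).2, oscSlope]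
  rw [etaT, hI, Real.sqrt_mul hlt.le, Real.sqrt_sq (norm_nonneg _), mul_assoc]

theorem IsStable.etaT_nonneg (hP : P.IsStable 𝒯₀ c C K) {𝒯 : TimeMesh} (hr : Refines 𝒯₀ 𝒯)
    {T : ℝ × ℝ} (hT : T ∈ 𝒯) : 0 ≤ P.etaT 𝒯 T :=
  mul_nonneg (hP.length_bounds hr hT).1.le (Real.sqrt_nonneg _)

theorem IsStable.etaT_sq (hP : P.IsStable 𝒯₀ c C K) {𝒯 : TimeMesh} (hr : Refines 𝒯₀ 𝒯)
    {T : ℝ × ℝ} (hT : T ∈ 𝒯) :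
    P.etaT 𝒯 T ^ 2 = (T.2 - T.1) * ((T.2 - T.1) ^ 2 * ‖P.oscSlope 𝒯 T‖ ^ 2) := by
  rw [hP.etaT_eq hr hT, mul_pow, mul_pow, Real.sq_sqrt (hP.length_bounds hr hT).1.le]
  ring

theorem eta_sq (𝒯 : TimeMesh) : P.eta 𝒯 ^ 2 = ∑ T ∈ 𝒯, P.etaT 𝒯 T ^ 2 :=
  Real.sq_sqrt (Finset.sum_nonneg fun _ _ => sq_nonneg _)

theorem eta_nonneg (𝒯 : TimeMesh) : 0 ≤ P.eta 𝒯 := Real.sqrt_nonneg _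

/-! ### Differences of Crank–Nicolson approximations -/

variable (P) in
/-- The difference of the Crank–Nicolson approximations on `𝒯'` and `𝒯`. -/
noncomputable def cnDiff (𝒯 𝒯' : TimeMesh) (t : ℝ) : V := P.cn 𝒯' t - P.cn 𝒯 t

variable {𝒯 𝒯' : TimeMesh}

theorem IsStable.cnDiff_zero (hP : P.IsStable 𝒯₀ c C K) (hr : Refines 𝒯₀ 𝒯)
    (hr' : Refines 𝒯 𝒯') : P.cnDiff 𝒯 𝒯' 0 = 0 :=
  sub_eq_zero.2 (P.ι.injective ((hP.isCrankNicolson (hr.trans hr')).initial.trans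
    (hP.isCrankNicolson hr).initial.symm))

theorem IsStable.cnDiff_affine (hP : P.IsStable 𝒯₀ c C K) (hr : Refines 𝒯₀ 𝒯)
    (hr' : Refines 𝒯 𝒯') : PiecewiseAffine 𝒯' (P.cnDiff 𝒯 𝒯') :=
  (hP.affine (hr.trans hr')).sub ((hP.affine hr).of_refines (hr.tiling hP.tiling) hr')

theorem slope_cnDiff (a b : ℝ) :
    slope (P.cnDiff 𝒯 𝒯') a b = slope (P.cn 𝒯') a b - slope (P.cn 𝒯) a b := by
  simp only [slope_def_module, cnDiff, ← smul_sub]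
  congr 1
  abel

theorem normX_cnDiff : P.normX (fun t => P.cn 𝒯 t - P.cn 𝒯' t) = P.normX (P.cnDiff 𝒯 𝒯') := by
  have h1 : (fun t => P.cn 𝒯 t - P.cn 𝒯' t) = fun t => -P.cnDiff 𝒯 𝒯' t := by
    funext t; simp [cnDiff]
  have h2 : (fun t => P.J (-P.cnDiff 𝒯 𝒯' t)) = fun t => -P.J (P.cnDiff 𝒯 𝒯' t) := by
    funext t; simp
  rw [h1, normX, normX, h2]
  simp [deriv.fun_neg]

theorem IsStable.oscSlope_sub (hP : P.IsStable 𝒯₀ c C K) (hr : Refines 𝒯₀ 𝒯)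
    (hr' : Refines 𝒯 𝒯') {X : ℝ × ℝ} (hX : X ∈ 𝒯') :
    P.oscSlope 𝒯' X =
      P.oscSlope 𝒯 (ancestor 𝒯 X) - P.A (slope (P.cnDiff 𝒯 𝒯') X.1 X.2) := by
  obtain ⟨h1, h2, h3, -⟩ := Refines.ancestor_spec (hr.tiling hP.tiling) hr' X hX
  have hlt : X.1 < X.2 := sub_pos.1 (hP.length_bounds (hr.trans hr') hX).1
  have hm : mid X ∈ Ioo (ancestor 𝒯 X).1 (ancestor 𝒯 X).2 :=
    ⟨by unfold mid; linarith, by unfold mid; linarith⟩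
  rw [oscSlope, oscSlope, (hP.load_affine hr h1 hm).2, slope_cnDiff, map_sub,
    (hP.affine hr).slope_eq h1 hlt h2 h3]
  abel

/-- The difference of two Crank–Nicolson approximations solves the scheme on the finer mesh with
a right-hand side that is the estimator density of the coarser one times the shift of the midpoints.
In particular it vanishes on elements that are not refined. -/
theorem IsStable.cnResidual_cnDiff (hP : P.IsStable 𝒯₀ c C K) (hr : Refines 𝒯₀ 𝒯)
    (hr' : Refines 𝒯 𝒯') {X : ℝ × ℝ} (hX : X ∈ 𝒯') :
    P.cnResidual (P.cnDiff 𝒯 𝒯') X =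
      (mid X - mid (ancestor 𝒯 X)) • P.oscSlope 𝒯 (ancestor 𝒯 X) := by
  obtain ⟨h1, h2, h3, -⟩ := Refines.ancestor_spec (hr.tiling hP.tiling) hr' X hX
  have hlt : X.1 < X.2 := sub_pos.1 (hP.length_bounds (hr.trans hr') hX).1
  set T := ancestor 𝒯 X
  have hltT : T.1 < T.2 := h2.trans_lt (hlt.trans_le h3)
  have hm : mid X ∈ Ioo T.1 T.2 := ⟨by unfold mid; linarith, by unfold mid; linarith⟩
  have e1 := (hP.isCrankNicolson (hr.trans hr')).step X hX
  have e2 := (hP.isCrankNicolson hr).step T h1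
  rw [← map_smul, ← slope_def_module] at e1 e2
  have e3 := (hP.affine hr).eq_of_mem h1 hltT ⟨hm.1.le, hm.2.le⟩
  rw [cnResidual, (hP.cnDiff_affine hr hr').endMean_eq hX hlt, slope_cnDiff,
    (hP.affine hr).slope_eq h1 hlt h2 h3, cnDiff, e3, oscSlope]
  have e4 := (hP.load_affine hr h1 hm).1
  rw [e4] at e1
  simp only [map_sub, map_add, map_smul, smul_sub]
  rw [← sub_eq_iff_eq_add.2 e1.symm, ← e2]
  abel

/-- `L²`-norm (squared) of the residuals in the scheme for the difference: it is controlled by the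
estimator on the refined elements alone. -/
theorem IsStable.sum_cnResidual_le (hP : P.IsStable 𝒯₀ c C K) (hr : Refines 𝒯₀ 𝒯)
    (hr' : Refines 𝒯 𝒯') :
    ∑ X ∈ 𝒯', (X.2 - X.1) * ‖P.cnResidual (P.cnDiff 𝒯 𝒯') X‖ ^ 2 ≤
      ∑ T ∈ 𝒯 \ 𝒯', P.etaT 𝒯 T ^ 2 := by
  have ht := hr.tiling hP.tiling
  have h1 : ∑ T ∈ 𝒯 \ 𝒯', P.etaT 𝒯 T ^ 2 = ∑ T ∈ 𝒯, (T.2 - T.1) *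
      (if T ∈ 𝒯' then 0 else (T.2 - T.1) ^ 2 * ‖P.oscSlope 𝒯 T‖ ^ 2) := by
    rw [Finset.sdiff_eq_filter, Finset.sum_filter]
    refine Finset.sum_congr rfl fun T hT => ?_
    rw [hP.etaT_sq hr hT]
    split_ifs <;> simp_all
  rw [h1, ← Refines.sum_ancestor ht hr']
  refine Finset.sum_le_sum fun X hX => ?_
  have hlt := (hP.length_bounds (hr.trans hr') hX).1
  refine mul_le_mul_of_nonneg_left ?_ hlt.le
  rw [hP.cnResidual_cnDiff hr hr' hX]
  split_ifs with hm
  · rw [Refines.ancestor_eq_of_mem ht hr' hX hm]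
    simp
  · obtain ⟨-, h2, h3, -⟩ := Refines.ancestor_spec ht hr' X hX
    rw [norm_smul, mul_pow, Real.norm_eq_abs, sq_abs]
    refine mul_le_mul_of_nonneg_right (sq_le_sq' ?_ ?_) (sq_nonneg _) <;>
      unfold mid <;> linarith

theorem IsStable.sum_slope_le (hP : P.IsStable 𝒯₀ c C K) (hr : Refines 𝒯₀ 𝒯)
    (hr' : Refines 𝒯 𝒯') :
    ∑ X ∈ 𝒯', (X.2 - X.1) * ‖P.J (slope (P.cnDiff 𝒯 𝒯') X.1 X.2)‖ ^ 2 ≤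
      2 * (c ^ 2 + C ^ 2) / c ^ 2 * ∑ T ∈ 𝒯 \ 𝒯', P.etaT 𝒯 T ^ 2 := by
  have h1 := (P.energy_estimate hP.c_pos hP.coercive hP.bounded
    ((hr.trans hr').tiling hP.tiling) (hP.cnDiff_zero hr hr')).2
  have hc := hP.c_pos
  rw [div_mul_eq_mul_div, le_div_iff₀ (by positivity), mul_comm]
  exact h1.trans (mul_le_mul_of_nonneg_left (hP.sum_cnResidual_le hr hr') (by positivity))

theorem IsStable.A_sq_le (hP : P.IsStable 𝒯₀ c C K) (v : V) :
    ‖P.A v‖ ^ 2 ≤ (C * K) ^ 2 * ‖P.J v‖ ^ 2 := by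
  rw [← mul_pow]
  refine pow_le_pow_left₀ (norm_nonneg _) ((hP.bounded v).trans ?_) 2
  rw [mul_assoc]
  exact mul_le_mul_of_nonneg_left (hP.inverse v) hP.C_nonneg

/-! ### Stability, reduction and discrete reliability -/

/-- Minkowski's inequality for finite sums, with the perturbation bounded in `ℓ²`. -/
theorem sqrt_sum_sq_le {ι : Type*} (S : Finset ι) (a b d : ι → ℝ) {X : ℝ} (hX : 0 ≤ X)
    (ha : ∀ i ∈ S, 0 ≤ a i) (hab : ∀ i ∈ S, a i ≤ b i + d i) (hd : ∑ i ∈ S, d i ^ 2 ≤ X ^ 2) :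
    Real.sqrt (∑ i ∈ S, a i ^ 2) ≤ Real.sqrt (∑ i ∈ S, b i ^ 2) + X := by
  set B := Real.sqrt (∑ i ∈ S, b i ^ 2)
  have hB : 0 ≤ B := Real.sqrt_nonneg _
  have hB2 : B ^ 2 = ∑ i ∈ S, b i ^ 2 := Real.sq_sqrt (Finset.sum_nonneg fun _ _ => sq_nonneg _)
  have h1 : ∑ i ∈ S, a i ^ 2 ≤ ∑ i ∈ S, (b i ^ 2 + 2 * (b i * d i) + d i ^ 2) :=
    Finset.sum_le_sum fun i hi =>
      (pow_le_pow_left₀ (ha i hi) (hab i hi) 2).trans_eq (by ring)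
  have h2 : ∑ i ∈ S, b i * d i ≤ B * X := by
    refine abs_le_of_sq_le_sq' ?_ (by positivity) |>.2
    rw [mul_pow, hB2]
    exact (Finset.sum_mul_sq_le_sq_mul_sq S b d).trans
      (mul_le_mul_of_nonneg_left hd (Finset.sum_nonneg fun _ _ => sq_nonneg _))
  rw [Finset.sum_add_distrib, Finset.sum_add_distrib, ← Finset.mul_sum, ← hB2] at h1
  refine Real.sqrt_le_iff.2 ⟨by positivity, ?_⟩
  nlinarith

theorem IsStable.A1 (hP : P.IsStable 𝒯₀ c C K) {M : ℝ} (hM : tEnd * (C * K) ≤ M) :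
    P.A1 𝒯₀ M := by
  intro 𝒯 𝒯' hr hr' S hS
  have htE := hP.tiling.bounds.1
  have ht := hr.tiling hP.tiling
  have hCK := mul_nonneg hP.C_nonneg hP.K_nonneg
  rw [normX_cnDiff]
  set N := P.normX (P.cnDiff 𝒯 𝒯')
  have hN : 0 ≤ N := Real.sqrt_nonneg _
  refine le_trans ?_ (mul_le_mul_of_nonneg_right hM hN)
  set d : ℝ × ℝ → ℝ := fun T =>
    (T.2 - T.1) * Real.sqrt (T.2 - T.1) * ‖P.A (slope (P.cnDiff 𝒯 𝒯') T.1 T.2)‖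
  have hd : ∑ T ∈ S, d T ^ 2 ≤ (tEnd * (C * K) * N) ^ 2 := by
    have h1 : ∑ T ∈ S, d T ^ 2 ≤ ∑ T ∈ S, (tEnd * (C * K)) ^ 2 *
        ((T.2 - T.1) * ‖P.J (slope (P.cnDiff 𝒯 𝒯') T.1 T.2)‖ ^ 2) := by
      refine Finset.sum_le_sum fun T hT => ?_
      obtain ⟨hl, hl'⟩ := hP.length_bounds hr (Finset.mem_inter.1 (hS hT)).1
      have h2 := hP.A_sq_le (slope (P.cnDiff 𝒯 𝒯') T.1 T.2)
      simp only [d, mul_pow, Real.sq_sqrt hl.le]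
      calc (T.2 - T.1) ^ 2 * (T.2 - T.1) * ‖P.A (slope (P.cnDiff 𝒯 𝒯') T.1 T.2)‖ ^ 2
          ≤ tEnd ^ 2 * (T.2 - T.1) *
            ((C * K) ^ 2 * ‖P.J (slope (P.cnDiff 𝒯 𝒯') T.1 T.2)‖ ^ 2) := by gcongr
        _ = _ := by ring
    refine h1.trans ?_
    rw [← Finset.mul_sum, mul_pow _ N]
    refine mul_le_mul_of_nonneg_left (le_trans ?_ (P.sum_slope_le_normX
      ((hr.trans hr').tiling hP.tiling) (hP.cnDiff_affine hr hr'))) (sq_nonneg _)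
    refine Finset.sum_le_sum_of_subset_of_nonneg (hS.trans Finset.inter_subset_right)
      fun X hX _ => mul_nonneg (hP.length_bounds (hr.trans hr') hX).1.le (sq_nonneg _)
  have hX : 0 ≤ tEnd * (C * K) * N := by positivity
  have heq : ∀ T ∈ S, P.etaT 𝒯' T ≤ P.etaT 𝒯 T + d T ∧ P.etaT 𝒯 T ≤ P.etaT 𝒯' T + d T := by
    intro T hT
    obtain ⟨hT1, hT2⟩ := Finset.mem_inter.1 (hS hT)
    have hl := (hP.length_bounds hr hT1).1
    have hw : 0 ≤ (T.2 - T.1) * Real.sqrt (T.2 - T.1) := by positivity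
    have ho := hP.oscSlope_sub hr hr' hT2
    rw [ht.isNonoverlapping.ancestor_self hT1] at ho
    rw [hP.etaT_eq hr hT1, hP.etaT_eq (hr.trans hr') hT2]
    simp only [d, ← mul_add]
    constructor
    · refine mul_le_mul_of_nonneg_left ?_ hw
      rw [ho]
      exact norm_sub_le _ _
    · refine mul_le_mul_of_nonneg_left ?_ hw
      rw [ho]
      exact norm_le_norm_sub_add _ _
  have e1 := sqrt_sum_sq_le S (P.etaT 𝒯') (P.etaT 𝒯) d hX
    (fun T hT => hP.etaT_nonneg (hr.trans hr') (Finset.mem_inter.1 (hS hT)).2)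
    (fun T hT => (heq T hT).1) hd
  have e2 := sqrt_sum_sq_le S (P.etaT 𝒯) (P.etaT 𝒯') d hX
    (fun T hT => hP.etaT_nonneg hr (Finset.mem_inter.1 (hS hT)).1)
    (fun T hT => (heq T hT).2) hd
  rw [abs_le]
  constructor <;> linarith

/-- The local estimator on a descendant, with Young's inequality for the perturbation. -/
theorem IsStable.etaT_sq_le (hP : P.IsStable 𝒯₀ c C K) (hr : Refines 𝒯₀ 𝒯)
    (hr' : Refines 𝒯 𝒯') {X : ℝ × ℝ} (hX : X ∈ 𝒯') {ε : ℝ} (hε : 0 < ε) :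
    P.etaT 𝒯' X ^ 2 ≤
      (1 + ε) * ((X.2 - X.1) * ((X.2 - X.1) ^ 2 * ‖P.oscSlope 𝒯 (ancestor 𝒯 X)‖ ^ 2)) +
      (1 + ε⁻¹) * ((C * K) ^ 2 * ((X.2 - X.1) ^ 2 *
        ((X.2 - X.1) * ‖P.J (slope (P.cnDiff 𝒯 𝒯') X.1 X.2)‖ ^ 2))) := by
  rw [hP.etaT_sq (hr.trans hr') hX, hP.oscSlope_sub hr hr' hX]
  have hl := (hP.length_bounds (hr.trans hr') hX).1
  set x := P.oscSlope 𝒯 (ancestor 𝒯 X)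
  set y := P.A (slope (P.cnDiff 𝒯 𝒯') X.1 X.2)
  have hy : ‖y‖ ^ 2 ≤ (C * K) ^ 2 * ‖P.J (slope (P.cnDiff 𝒯 𝒯') X.1 X.2)‖ ^ 2 := hP.A_sq_le _
  have h1 : ‖x - y‖ ^ 2 ≤ (1 + ε) * ‖x‖ ^ 2 + (1 + ε⁻¹) * ‖y‖ ^ 2 := by
    have h2 := pow_le_pow_left₀ (norm_nonneg _) (norm_sub_le x y) 2
    have h3 : 0 ≤ ε⁻¹ * (ε * ‖x‖ - ‖y‖) ^ 2 := by positivity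
    have h4 : ε⁻¹ * (ε * ‖x‖ - ‖y‖) ^ 2 = ε * ‖x‖ ^ 2 - 2 * ‖x‖ * ‖y‖ + ε⁻¹ * ‖y‖ ^ 2 := by
      field_simp
      ring
    nlinarith
  calc (X.2 - X.1) * ((X.2 - X.1) ^ 2 * ‖x - y‖ ^ 2)
      ≤ (X.2 - X.1) * ((X.2 - X.1) ^ 2 * ((1 + ε) * ‖x‖ ^ 2 + (1 + ε⁻¹) *
          ((C * K) ^ 2 * ‖P.J (slope (P.cnDiff 𝒯 𝒯') X.1 X.2)‖ ^ 2))) := by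
        refine mul_le_mul_of_nonneg_left (mul_le_mul_of_nonneg_left (h1.trans ?_)
          (sq_nonneg _)) hl.le
        gcongr
    _ = _ := by ring

theorem IsStable.A2 (hP : P.IsStable 𝒯₀ c C K) {M : ℝ}
    (hM : 2 * (tEnd * (C * K)) ^ 2 ≤ M) : P.A2 𝒯₀ (1 / 2) M := by
  intro 𝒯 𝒯' hr hr'
  have ht := hr.tiling hP.tiling
  rw [normX_cnDiff]
  have h1 : ∑ X ∈ 𝒯' \ 𝒯, P.etaT 𝒯' X ^ 2 ≤ ∑ X ∈ 𝒯', ((1 / 2) * ((X.2 - X.1) *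
        (if ancestor 𝒯 X ∈ 𝒯' then 0 else ((ancestor 𝒯 X).2 - (ancestor 𝒯 X).1) ^ 2 *
          ‖P.oscSlope 𝒯 (ancestor 𝒯 X)‖ ^ 2)) + 2 * (tEnd * (C * K)) ^ 2 *
        ((X.2 - X.1) * ‖P.J (slope (P.cnDiff 𝒯 𝒯') X.1 X.2)‖ ^ 2)) := by
    refine (Finset.sum_le_sum fun X hX => ?_).trans (Finset.sum_le_sum_of_subset_of_nonneg
      Finset.sdiff_subset fun X hX _ => ?_)
    · obtain ⟨hX, hX'⟩ := Finset.mem_sdiff.1 hX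
      obtain ⟨hl, hl'⟩ := hP.length_bounds (hr.trans hr') hX
      obtain ⟨h1, -, -, h4⟩ := Refines.ancestor_spec ht hr' X hX
      have h5 : ancestor 𝒯 X ∉ 𝒯' := fun h => hX' ((Refines.ancestor_mem_iff ht hr' hX).1 h)
      have h6 : X.2 - X.1 ≤ ((ancestor 𝒯 X).2 - (ancestor 𝒯 X).1) / 2 :=
        h4.resolve_left fun h => hX' (h ▸ h1)
      refine (hP.etaT_sq_le hr hr' hX one_pos).trans ?_
      rw [if_neg h5]
      have h7 : (X.2 - X.1) ^ 2 ≤ ((ancestor 𝒯 X).2 - (ancestor 𝒯 X).1) ^ 2 / 4 := by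
        have := pow_le_pow_left₀ hl.le h6 2
        linarith
      have h8 : (X.2 - X.1) ^ 2 ≤ tEnd ^ 2 := pow_le_pow_left₀ hl.le hl' 2
      refine add_le_add ?_ ?_
      · calc _ ≤ (1 + 1) * ((X.2 - X.1) * (((ancestor 𝒯 X).2 - (ancestor 𝒯 X).1) ^ 2 / 4 *
              ‖P.oscSlope 𝒯 (ancestor 𝒯 X)‖ ^ 2)) := by gcongr
          _ = _ := by ring
      · calc _ ≤ (1 + 1⁻¹) * ((C * K) ^ 2 * (tEnd ^ 2 *
              ((X.2 - X.1) * ‖P.J (slope (P.cnDiff 𝒯 𝒯') X.1 X.2)‖ ^ 2))) := by gcongr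
          _ = _ := by ring
    · have hl := (hP.length_bounds (hr.trans hr') hX).1
      split_ifs <;> positivity
  refine h1.trans ?_
  rw [Finset.sum_add_distrib, ← Finset.mul_sum, ← Finset.mul_sum]
  refine add_le_add (le_of_eq ?_) (mul_le_mul hM (P.sum_slope_le_normX
    ((hr.trans hr').tiling hP.tiling) (hP.cnDiff_affine hr hr'))
    (Finset.sum_nonneg fun X hX =>
      mul_nonneg (hP.length_bounds (hr.trans hr') hX).1.le (sq_nonneg _))
    (le_trans (by positivity) hM))
  rw [Refines.sum_ancestor ht hr' fun T =>
    if T ∈ 𝒯' then 0 else (T.2 - T.1) ^ 2 * ‖P.oscSlope 𝒯 T‖ ^ 2, Finset.sdiff_eq_filter,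
    Finset.sum_filter]
  congr 1
  refine Finset.sum_congr rfl fun T hT => ?_
  rw [hP.etaT_sq hr hT]
  split_ifs <;> simp_all

theorem IsStable.A4 (hP : P.IsStable 𝒯₀ c C K) {M : ℝ} (hM : 2 / c ^ 2 +
    (tEnd ^ 2 / 2 * K ^ 2 + 1) * (2 * (c ^ 2 + C ^ 2) / c ^ 2) ≤ M ^ 2) : P.A4 𝒯₀ 1 M := by
  intro 𝒯 𝒯' hr hr'
  refine ⟨𝒯 \ 𝒯', Finset.sdiff_subset, subset_rfl, by simp, ?_⟩
  have ht' := (hr.trans hr').tiling hP.tiling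
  have hc := hP.c_pos
  set E := ∑ T ∈ 𝒯 \ 𝒯', P.etaT 𝒯 T ^ 2
  have hE : 0 ≤ E := Finset.sum_nonneg fun _ _ => sq_nonneg _
  change P.normX (P.cnDiff 𝒯 𝒯') ^ 2 ≤ _
  refine le_trans ?_ (mul_le_mul_of_nonneg_right hM hE)
  have h1 := (P.energy_estimate hP.c_pos hP.coercive hP.bounded ht' (hP.cnDiff_zero hr hr')).1
  have h2 := h1.trans (hP.sum_cnResidual_le hr hr')
  have h2' : ∑ X ∈ 𝒯', (X.2 - X.1) * ‖endMean (P.cnDiff 𝒯 𝒯') X‖ ^ 2 ≤ E / c ^ 2 := by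
    rw [le_div_iff₀ (by positivity), mul_comm]
    exact h2
  have h3 := hP.sum_slope_le hr hr'
  have h4 : P.normX (P.cnDiff 𝒯 𝒯') ^ 2 ≤ ∑ X ∈ 𝒯',
      (2 * ((X.2 - X.1) * ‖endMean (P.cnDiff 𝒯 𝒯') X‖ ^ 2) + (tEnd ^ 2 / 2 * K ^ 2 + 1) *
        ((X.2 - X.1) * ‖P.J (slope (P.cnDiff 𝒯 𝒯') X.1 X.2)‖ ^ 2)) := by
    refine (P.normX_sq_le ht' (hP.cnDiff_affine hr hr')).trans (Finset.sum_le_sum fun X hX => ?_)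
    obtain ⟨hl, hl'⟩ := hP.length_bounds (hr.trans hr') hX
    set w := slope (P.cnDiff 𝒯 𝒯') X.1 X.2
    have h5 : ‖w‖ ^ 2 ≤ K ^ 2 * ‖P.J w‖ ^ 2 := by
      rw [← mul_pow]
      exact pow_le_pow_left₀ (norm_nonneg _) (hP.inverse w) 2
    calc _ ≤ (X.2 - X.1) * (2 * ‖endMean (P.cnDiff 𝒯 𝒯') X‖ ^ 2 +
          tEnd ^ 2 / 2 * (K ^ 2 * ‖P.J w‖ ^ 2) + ‖P.J w‖ ^ 2) := by gcongr
      _ = _ := by ring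
  rw [Finset.sum_add_distrib, ← Finset.mul_sum, ← Finset.mul_sum] at h4
  calc _ ≤ 2 * (E / c ^ 2) + (tEnd ^ 2 / 2 * K ^ 2 + 1) *
        (2 * (c ^ 2 + C ^ 2) / c ^ 2 * E) := h4.trans (by gcongr)
    _ = _ := by ring

/-! ### Contraction for the bisection of short elements -/

theorem cnResidual_eq_children (v : ℝ → V) {T : ℝ × ℝ} (hT : T.1 < T.2) :
    P.cnResidual v T =
      (1 / 2 : ℝ) • (P.cnResidual v (T.1, mid T) + P.cnResidual v (mid T, T.2)) +
        P.A (((T.2 - T.1) / 8) • (slope v (mid T) T.2 - slope v T.1 (mid T))) := by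
  have hne : T.2 - T.1 ≠ 0 := by linarith
  have e1 : slope v T.1 T.2 = (1 / 2 : ℝ) • (slope v T.1 (mid T) + slope v (mid T) T.2) := by
    simp only [slope_def_module, mid_sub_fst, snd_sub_mid, inv_div]
    rw [← smul_add, smul_smul, show (1 / 2 : ℝ) * (2 / (T.2 - T.1)) = (T.2 - T.1)⁻¹ by field_simp]
    congr 1
    abel
  have e2 : endMean v T = (1 / 2 : ℝ) • (endMean v (T.1, mid T) + endMean v (mid T, T.2)) +
      ((T.2 - T.1) / 8) • (slope v (mid T) T.2 - slope v T.1 (mid T)) := by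
    simp only [slope_def_module, mid_sub_fst, snd_sub_mid, inv_div, endMean]
    rw [← smul_sub, smul_smul, show (T.2 - T.1) / 8 * (2 / (T.2 - T.1)) = 1 / 4 by
      field_simp; norm_num]
    module
  simp only [cnResidual]
  rw [e1, e2]
  simp only [map_add, map_smul, smul_add]
  abel

/-- Superconvergence: the piecewise affine interpolant on the coarse mesh of the difference of two
consecutive approximations is smaller than the difference itself by a factor of the length of the
bisected elements, since the two residuals on a bisected element cancel. -/
theorem IsStable.sum_coarse_slope_le (hP : P.IsStable 𝒯₀ c C K) (hr : Refines 𝒯₀ 𝒯)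
    {ℳ : TimeMesh} (hℳ : ℳ ⊆ 𝒯) {δ : ℝ} (hδ : ∀ T ∈ ℳ, T.2 - T.1 ≤ δ) :
    ∑ T ∈ 𝒯, (T.2 - T.1) * ‖P.J (slope (P.cnDiff 𝒯 (bisect 𝒯 ℳ)) T.1 T.2)‖ ^ 2 ≤
      2 * (c ^ 2 + C ^ 2) / c ^ 2 * ((C * K) ^ 2 * δ ^ 2 / 16 * ∑ X ∈ bisect 𝒯 ℳ,
        (X.2 - X.1) * ‖P.J (slope (P.cnDiff 𝒯 (bisect 𝒯 ℳ)) X.1 X.2)‖ ^ 2) := by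
  have ht := hr.tiling hP.tiling
  have hno := ht.isNonoverlapping
  have hr' := Refines.bisect hℳ
  have hc := hP.c_pos
  set D := P.cnDiff 𝒯 (bisect 𝒯 ℳ)
  have h1 := (P.energy_estimate hP.c_pos hP.coercive hP.bounded ht (hP.cnDiff_zero hr hr')).2
  have h2 : ∑ T ∈ 𝒯, (T.2 - T.1) * ‖P.cnResidual D T‖ ^ 2 ≤ (C * K) ^ 2 * δ ^ 2 / 16 *
      ∑ X ∈ bisect 𝒯 ℳ, (X.2 - X.1) * ‖P.J (slope D X.1 X.2)‖ ^ 2 := by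
    rw [hno.sum_bisect hℳ, ← Finset.sum_sdiff hℳ]
    have hun : ∑ T ∈ 𝒯 \ ℳ, (T.2 - T.1) * ‖P.cnResidual D T‖ ^ 2 = 0 := by
      refine Finset.sum_eq_zero fun T hT => ?_
      obtain ⟨hT, hT'⟩ := Finset.mem_sdiff.1 hT
      rw [hP.cnResidual_cnDiff hr hr' (mem_bisect.2 (Or.inl ⟨hT, hT'⟩)), hno.ancestor_self hT]
      simp
    have hnn : 0 ≤ ∑ T ∈ 𝒯 \ ℳ, (T.2 - T.1) * ‖P.J (slope D T.1 T.2)‖ ^ 2 :=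
      Finset.sum_nonneg fun T hT => mul_nonneg
        (hP.length_bounds hr (Finset.mem_sdiff.1 hT).1).1.le (sq_nonneg _)
    rw [hun, zero_add]
    refine le_trans ?_ (mul_le_mul_of_nonneg_left (le_add_of_nonneg_left hnn) (by positivity))
    rw [Finset.mul_sum]
    refine Finset.sum_le_sum fun T hT => ?_
    have hlt := hno.lt T (hℳ hT)
    have hch : ∀ X ∈ children T, P.cnResidual D X = (mid X - mid T) • P.oscSlope 𝒯 T := by
      intro X hX
      obtain ⟨g1, g2, g3, -⟩ := children_spec hlt hX
      rw [hP.cnResidual_cnDiff hr hr' (mem_bisect.2 (Or.inr ⟨T, hT, hX⟩)),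
        hno.ancestor_eq (hℳ hT) g2 g1 g3]
    have hcancel : P.cnResidual D (T.1, mid T) + P.cnResidual D (mid T, T.2) = 0 := by
      rw [hch _ (by simp [children]), hch _ (by simp [children]), ← add_smul]
      convert zero_smul ℝ _
      simp only [mid]
      ring
    rw [cnResidual_eq_children D hlt, hcancel, smul_zero, zero_add]
    set d₁ := slope D T.1 (mid T)
    set d₂ := slope D (mid T) T.2
    have hl : 0 < T.2 - T.1 := sub_pos.2 hlt
    have h3 := hP.A_sq_le (((T.2 - T.1) / 8) • (d₂ - d₁))
    rw [map_smul P.J, norm_smul, mul_pow _ ‖P.J (d₂ - d₁)‖, Real.norm_eq_abs, sq_abs, map_sub] at h3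
    have h4 : ‖P.J d₂ - P.J d₁‖ ^ 2 ≤ 2 * (‖P.J d₁‖ ^ 2 + ‖P.J d₂‖ ^ 2) := by
      have := pow_le_pow_left₀ (norm_nonneg _) (norm_sub_le (P.J d₂) (P.J d₁)) 2
      nlinarith [sq_nonneg (‖P.J d₂‖ - ‖P.J d₁‖)]
    have h5 : (T.2 - T.1) ^ 2 ≤ δ ^ 2 := pow_le_pow_left₀ hl.le (hδ T hT) 2
    dsimp only
    rw [mid_sub_fst, snd_sub_mid]
    calc _ ≤ (T.2 - T.1) * ((C * K) ^ 2 * (((T.2 - T.1) / 8) ^ 2 *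
          (2 * (‖P.J d₁‖ ^ 2 + ‖P.J d₂‖ ^ 2)))) := by
          refine mul_le_mul_of_nonneg_left (h3.trans ?_) hl.le
          gcongr
      _ = (C * K) ^ 2 * ((T.2 - T.1) ^ 2) / 16 * ((T.2 - T.1) / 2 * ‖P.J d₁‖ ^ 2 +
          (T.2 - T.1) / 2 * ‖P.J d₂‖ ^ 2) := by ring
      _ ≤ _ := by gcongr
  rw [div_mul_eq_mul_div, le_div_iff₀ (by positivity), mul_comm]
  exact h1.trans (mul_le_mul_of_nonneg_left h2 (by positivity))

/-- Perturbed contraction: if only elements of length at most `δ` are bisected, the estimator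
decreases up to a relative perturbation of order `δ`. No orthogonality is needed. -/
theorem IsStable.eta_bisect_le (hP : P.IsStable 𝒯₀ c C K) (hr : Refines 𝒯₀ 𝒯)
    {ℳ : TimeMesh} (hℳ : ℳ ⊆ 𝒯) {δ : ℝ} (hδ : ∀ T ∈ ℳ, T.2 - T.1 ≤ δ) {ε R : ℝ} (hε : 0 < ε)
    (hR : R = 2 * (c ^ 2 + C ^ 2) / c ^ 2) :
    P.eta (bisect 𝒯 ℳ) ^ 2 ≤
      (1 + ε) * (P.eta 𝒯 ^ 2 - 3 / 4 * ∑ T ∈ ℳ, P.etaT 𝒯 T ^ 2) +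
      (1 + ε⁻¹) * ((C * K) ^ 2 * (1 + tEnd ^ 2 * (R * ((C * K) ^ 2 / 16))) * R * δ ^ 2) *
        P.eta 𝒯 ^ 2 := by
  have ht := hr.tiling hP.tiling
  have hno := ht.isNonoverlapping
  have hr' := Refines.bisect hℳ
  have hc := hP.c_pos
  have hR0 : 0 ≤ R := by rw [hR]; positivity
  have hfine := hP.sum_slope_le hr hr'
  have hcoarse := hP.sum_coarse_slope_le hr hℳ hδ
  rw [← hR] at hfine hcoarse
  set D := P.cnDiff 𝒯 (bisect 𝒯 ℳ)
  set S := ∑ X ∈ bisect 𝒯 ℳ, (X.2 - X.1) * ‖P.J (slope D X.1 X.2)‖ ^ 2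
  have hlen : ∀ X ∈ bisect 𝒯 ℳ, 0 < X.2 - X.1 := fun X hX =>
    (hP.length_bounds (hr.trans hr') hX).1
  have hSE : S ≤ R * P.eta 𝒯 ^ 2 := by
    refine hfine.trans (mul_le_mul_of_nonneg_left ?_ hR0)
    rw [eta_sq]
    exact Finset.sum_le_sum_of_subset_of_nonneg Finset.sdiff_subset fun _ _ _ => sq_nonneg _
  have h1 : P.eta (bisect 𝒯 ℳ) ^ 2 ≤ (1 + ε) * (∑ X ∈ bisect 𝒯 ℳ, (X.2 - X.1) *
        ((X.2 - X.1) ^ 2 * ‖P.oscSlope 𝒯 (ancestor 𝒯 X)‖ ^ 2)) +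
      (1 + ε⁻¹) * ((C * K) ^ 2 * ∑ X ∈ bisect 𝒯 ℳ, (X.2 - X.1) ^ 2 *
        ((X.2 - X.1) * ‖P.J (slope D X.1 X.2)‖ ^ 2)) := by
    rw [eta_sq, Finset.mul_sum, Finset.mul_sum, Finset.mul_sum, ← Finset.sum_add_distrib]
    exact Finset.sum_le_sum fun X hX => hP.etaT_sq_le hr hr' hX hε
  have h2 : ∑ X ∈ bisect 𝒯 ℳ, (X.2 - X.1) *
      ((X.2 - X.1) ^ 2 * ‖P.oscSlope 𝒯 (ancestor 𝒯 X)‖ ^ 2) =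
      P.eta 𝒯 ^ 2 - 3 / 4 * ∑ T ∈ ℳ, P.etaT 𝒯 T ^ 2 := by
    rw [eta_sq, ← Finset.sum_sdiff hℳ, hno.sum_bisect hℳ, add_sub_assoc,
      show ∀ x : ℝ, x - 3 / 4 * x = 1 / 4 * x by intro x; ring, Finset.mul_sum]
    congr 1
    · refine Finset.sum_congr rfl fun T hT => ?_
      have hT := (Finset.mem_sdiff.1 hT).1
      rw [hno.ancestor_self hT, hP.etaT_sq hr hT]
    · refine Finset.sum_congr rfl fun T hT => ?_
      have hlt := hno.lt T (hℳ hT)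
      have hch : ∀ X ∈ children T, ancestor 𝒯 X = T := fun X hX => by
        obtain ⟨g1, g2, g3, -⟩ := children_spec hlt hX
        exact hno.ancestor_eq (hℳ hT) g2 g1 g3
      rw [hch _ (by simp [children]), hch _ (by simp [children])]
      dsimp only
      rw [mid_sub_fst, snd_sub_mid, hP.etaT_sq hr (hℳ hT)]
      ring
  have h3 : ∑ X ∈ bisect 𝒯 ℳ, (X.2 - X.1) ^ 2 *
      ((X.2 - X.1) * ‖P.J (slope D X.1 X.2)‖ ^ 2) ≤ δ ^ 2 * S +
      tEnd ^ 2 * ∑ T ∈ 𝒯, (T.2 - T.1) * ‖P.J (slope D T.1 T.2)‖ ^ 2 := by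
    have hφ : ∀ T ∈ 𝒯, 0 ≤ (T.2 - T.1) * ‖P.J (slope D T.1 T.2)‖ ^ 2 := fun T hT =>
      mul_nonneg (hP.length_bounds hr hT).1.le (sq_nonneg _)
    have ha : ∑ T ∈ 𝒯 \ ℳ, (T.2 - T.1) ^ 2 * ((T.2 - T.1) * ‖P.J (slope D T.1 T.2)‖ ^ 2) ≤
        tEnd ^ 2 * ∑ T ∈ 𝒯, (T.2 - T.1) * ‖P.J (slope D T.1 T.2)‖ ^ 2 := by
      rw [Finset.mul_sum]
      refine (Finset.sum_le_sum fun T hT => ?_).trans (Finset.sum_le_sum_of_subset_of_nonneg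
        Finset.sdiff_subset fun T hT _ => mul_nonneg (sq_nonneg _) (hφ T hT))
      have hT := (Finset.mem_sdiff.1 hT).1
      obtain ⟨hl, hl'⟩ := hP.length_bounds hr hT
      exact mul_le_mul_of_nonneg_right (pow_le_pow_left₀ hl.le hl' 2) (hφ T hT)
    simp only [S]
    rw [hno.sum_bisect hℳ, hno.sum_bisect hℳ, add_comm]
    refine add_le_add ?_ ha
    have hb : 0 ≤ ∑ T ∈ 𝒯 \ ℳ, (T.2 - T.1) * ‖P.J (slope D T.1 T.2)‖ ^ 2 :=
      Finset.sum_nonneg fun T hT => hφ T (Finset.mem_sdiff.1 hT).1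
    refine le_trans ?_ (mul_le_mul_of_nonneg_left (le_add_of_nonneg_left hb) (sq_nonneg _))
    rw [Finset.mul_sum]
    refine Finset.sum_le_sum fun T hT => ?_
    have hl : 0 < T.2 - T.1 := sub_pos.2 (hno.lt T (hℳ hT))
    have hl' := hδ T hT
    dsimp only
    rw [mid_sub_fst, snd_sub_mid, mul_add]
    have hsq : ((T.2 - T.1) / 2) ^ 2 ≤ δ ^ 2 := pow_le_pow_left₀ (by linarith) (by linarith) 2
    gcongr
  have hCK : 0 ≤ (C * K) ^ 2 := sq_nonneg _
  calc P.eta (bisect 𝒯 ℳ) ^ 2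
      ≤ (1 + ε) * (P.eta 𝒯 ^ 2 - 3 / 4 * ∑ T ∈ ℳ, P.etaT 𝒯 T ^ 2) + (1 + ε⁻¹) * ((C * K) ^ 2 *
          (δ ^ 2 * S + tEnd ^ 2 * (R * ((C * K) ^ 2 * δ ^ 2 / 16 * S)))) := by
        rw [← h2]
        refine h1.trans ?_
        gcongr
        exact h3.trans (by gcongr)
    _ = (1 + ε) * (P.eta 𝒯 ^ 2 - 3 / 4 * ∑ T ∈ ℳ, P.etaT 𝒯 T ^ 2) + (1 + ε⁻¹) *
          ((C * K) ^ 2 * (1 + tEnd ^ 2 * (R * ((C * K) ^ 2 / 16))) * δ ^ 2) * S := by ring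
    _ ≤ (1 + ε) * (P.eta 𝒯 ^ 2 - 3 / 4 * ∑ T ∈ ℳ, P.etaT 𝒯 T ^ 2) + (1 + ε⁻¹) *
          ((C * K) ^ 2 * (1 + tEnd ^ 2 * (R * ((C * K) ^ 2 / 16))) * δ ^ 2) *
          (R * P.eta 𝒯 ^ 2) := by gcongr
    _ = _ := by ring

end ParabolicProblem

end AdaptiveTime

namespace AdaptiveTime

namespace ParabolicProblem

universe u v

section

variable {V H : Type*} [NormedAddCommGroup V] [InnerProductSpace ℝ V] [FiniteDimensional ℝ V]
  [NormedAddCommGroup H] [InnerProductSpace ℝ H] {tEnd : ℝ} {P : ParabolicProblem V H tEnd}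
  {𝒯₀ : TimeMesh}

/-! ### Linear convergence of the adaptive algorithm -/

/-- Quasi-monotonicity of the estimator follows from stability, reduction and discrete
reliability. -/
theorem eta_sq_le_of_refines {Cstab Cred Cref Cdlr : ℝ} (hs : 1 ≤ Cstab) (hred : 1 ≤ Cred)
    (h1 : P.A1 𝒯₀ Cstab) (h2 : P.A2 𝒯₀ (1 / 2) Cred) (h4 : P.A4 𝒯₀ Cref Cdlr)
    {𝒯 𝒯' : TimeMesh} (hr : Refines 𝒯₀ 𝒯) (hr' : Refines 𝒯 𝒯') :
    P.eta 𝒯' ^ 2 ≤ (3 + (Cred + 2 * Cstab ^ 2) * Cdlr ^ 2) * P.eta 𝒯 ^ 2 := by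
  obtain ⟨ℛ, hℛ, -, -, hd⟩ := h4 𝒯 𝒯' hr hr'
  have e1 := h1 𝒯 𝒯' hr hr' (𝒯 ∩ 𝒯') subset_rfl
  have e2 := h2 𝒯 𝒯' hr hr'
  rw [normX_cnDiff] at e1 e2
  change P.normX (P.cnDiff 𝒯 𝒯') ^ 2 ≤ _ at hd
  set N := P.normX (P.cnDiff 𝒯 𝒯')
  have hN : 0 ≤ N := Real.sqrt_nonneg _
  set E := P.eta 𝒯 ^ 2
  have hle : ∀ S ⊆ 𝒯, ∑ T ∈ S, P.etaT 𝒯 T ^ 2 ≤ E := fun S hS => by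
    simp only [E, eta_sq]
    exact Finset.sum_le_sum_of_subset_of_nonneg hS fun _ _ _ => sq_nonneg _
  have hN2 : N ^ 2 ≤ Cdlr ^ 2 * E := hd.trans (mul_le_mul_of_nonneg_left (hle ℛ hℛ) (sq_nonneg _))
  have e3 := hle _ (Finset.sdiff_subset (s := 𝒯) (t := 𝒯'))
  have e4 := hle _ (Finset.inter_subset_left (s₁ := 𝒯) (s₂ := 𝒯'))
  have hE : 0 ≤ E := sq_nonneg _
  have h5 : ∑ T ∈ 𝒯 ∩ 𝒯', P.etaT 𝒯' T ^ 2 ≤ 2 * E + 2 * Cstab ^ 2 * N ^ 2 := by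
    have hn : ∀ 𝒮, 0 ≤ ∑ T ∈ 𝒯 ∩ 𝒯', P.etaT 𝒮 T ^ 2 := fun _ =>
      Finset.sum_nonneg fun _ _ => sq_nonneg _
    have h6 := (abs_le.1 e1).2
    have h7 := Real.sq_sqrt (hn 𝒯')
    have h8 := Real.sq_sqrt (hn 𝒯)
    set a := Real.sqrt (∑ T ∈ 𝒯 ∩ 𝒯', P.etaT 𝒯' T ^ 2)
    set b := Real.sqrt (∑ T ∈ 𝒯 ∩ 𝒯', P.etaT 𝒯 T ^ 2)
    have h9 : a ^ 2 ≤ (b + Cstab * N) ^ 2 := pow_le_pow_left₀ (Real.sqrt_nonneg _) (by linarith) 2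
    nlinarith [sq_nonneg (b - Cstab * N)]
  rw [eta_sq, ← Finset.sum_sdiff (Finset.inter_subset_right (s₁ := 𝒯) (s₂ := 𝒯')),
    Finset.inter_comm 𝒯 𝒯', Finset.sdiff_inter_self_left, Finset.inter_comm 𝒯' 𝒯]
  have h10 : 0 ≤ Cred + 2 * Cstab ^ 2 := by positivity
  nlinarith [mul_le_mul_of_nonneg_left hN2 h10]

theorem IsAdaptiveRun.refines_add {θ : ℝ} {𝒯 ℳ : ℕ → TimeMesh} (h : P.IsAdaptiveRun 𝒯₀ θ 𝒯 ℳ)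
    (k n : ℕ) : Refines (𝒯 k) (𝒯 (k + n)) := by
  induction n with
  | zero => exact .refl
  | succ n ih =>
    rw [← add_assoc, h.refine]
    exact ih.trans (Refines.bisect (h.mark _).1)

theorem IsAdaptiveRun.refines {θ : ℝ} {𝒯 ℳ : ℕ → TimeMesh} (h : P.IsAdaptiveRun 𝒯₀ θ 𝒯 ℳ)
    (k : ℕ) : Refines 𝒯₀ (𝒯 k) := by
  simpa [h.init] using h.refines_add 0 k

theorem IsAdaptiveRun.card_eq {θ : ℝ} {𝒯 ℳ : ℕ → TimeMesh} (h : P.IsAdaptiveRun 𝒯₀ θ 𝒯 ℳ)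
    (ht : Tiling tEnd 𝒯₀) (k : ℕ) :
    (𝒯 k).card = 𝒯₀.card + ∑ j ∈ Finset.range k, (ℳ j).card := by
  induction k with
  | zero => simp [h.init]
  | succ k ih =>
    rw [h.refine, ((h.refines k).tiling ht).isNonoverlapping.card_bisect (h.mark k).1, ih,
      Finset.sum_range_succ, add_assoc]

/-- The sum of the squared element lengths, a potential that decreases by a fixed amount whenever
a long element is bisected. -/
noncomputable def sqLength (𝒯 : TimeMesh) : ℝ := ∑ T ∈ 𝒯, (T.2 - T.1) ^ 2

theorem sqLength_bisect {𝒯 ℳ : TimeMesh} (h : IsNonoverlapping 𝒯) (hℳ : ℳ ⊆ 𝒯) :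
    sqLength (bisect 𝒯 ℳ) = sqLength 𝒯 - 1 / 2 * ∑ T ∈ ℳ, (T.2 - T.1) ^ 2 := by
  rw [sqLength, sqLength, h.sum_bisect hℳ, ← Finset.sum_sdiff hℳ, add_sub_assoc]
  congr 1
  rw [Finset.mul_sum, ← Finset.sum_sub_distrib]
  refine Finset.sum_congr rfl fun T _ => ?_
  dsimp only
  rw [mid_sub_fst, snd_sub_mid]
  ring

theorem sqLength_nonneg (𝒯 : TimeMesh) : 0 ≤ sqLength 𝒯 :=
  Finset.sum_nonneg fun _ _ => sq_nonneg _

theorem sqLength_le {t : ℝ} {𝒯 : TimeMesh} (h : Tiling t 𝒯) : sqLength 𝒯 ≤ t ^ 2 := by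
  have h1 : sqLength 𝒯 ≤ ∑ T ∈ 𝒯, t * (T.2 - T.1) := by
    refine Finset.sum_le_sum fun T hT => ?_
    have := h.bounds.2 T hT
    nlinarith
  rw [← Finset.mul_sum, h.sum_length] at h1
  linarith [sq t]

end

/-- Linear convergence with constants independent of the problem. If all marked elements are short,
the estimator contracts; each of the other steps, in which it grows by at most the factor `M`,
consumes a fixed amount of the potential `sqLength`. Hence `η² exp (μ sqLength)` contracts in
every step. -/
theorem exists_linear_convergence {tEnd c C K M θ : ℝ} (hc : 0 < c) (hM : 1 ≤ M) (hθ : 0 < θ)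
    (hθ1 : θ < 1) :
    ∃ q Λ : ℝ, 0 < q ∧ q < 1 ∧ 0 < Λ ∧
      ∀ (V : Type u) [NormedAddCommGroup V] [InnerProductSpace ℝ V] [FiniteDimensional ℝ V]
        (H : Type v) [NormedAddCommGroup H] [InnerProductSpace ℝ H]
        (P : ParabolicProblem V H tEnd) (𝒯₀ : TimeMesh), P.IsStable 𝒯₀ c C K →
        (∀ 𝒯 𝒯' : TimeMesh, Refines 𝒯₀ 𝒯 → Refines 𝒯 𝒯' → P.eta 𝒯' ^ 2 ≤ M * P.eta 𝒯 ^ 2) →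
        ∀ 𝒯 ℳ : ℕ → TimeMesh, P.IsAdaptiveRun 𝒯₀ θ 𝒯 ℳ → ∀ k n,
          P.eta (𝒯 (k + n)) ^ 2 ≤ Λ * q ^ n * P.eta (𝒯 k) ^ 2 := by
  set R := 2 * (c ^ 2 + C ^ 2) / c ^ 2 with hR
  set B := (C * K) ^ 2 * (1 + tEnd ^ 2 * (R * ((C * K) ^ 2 / 16))) * R with hB
  have hR0 : 0 ≤ R := by positivity
  have hB0 : 0 ≤ B := by positivity
  -- `ε = θ / 4` in Young's inequality turns the factor `1 - 3θ/4` into at most `1 - θ/2`, and `δ`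
  -- is so small that the perturbation costs at most another `θ / 4`.
  set ε := θ / 4 with hεdef
  have hε : 0 < ε := by positivity
  set δ := Real.sqrt (ε / ((1 + ε⁻¹) * (B + 1))) with hδdef
  have hδ2 : δ ^ 2 = ε / ((1 + ε⁻¹) * (B + 1)) := Real.sq_sqrt (by positivity)
  have hδ : 0 < δ := Real.sqrt_pos.2 (by positivity)
  have hpert : (1 + ε⁻¹) * (B * δ ^ 2) ≤ ε := by
    rw [hδ2]
    have : (1 + ε⁻¹) * (B * (ε / ((1 + ε⁻¹) * (B + 1)))) = ε * (B / (B + 1)) := by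
      field_simp
    rw [this]
    exact mul_le_of_le_one_right hε.le ((div_le_one (by positivity)).2 (by linarith))
  set q := 1 - ε with hq
  have hq0 : 0 < q := by linarith
  have hq1 : q < 1 := by linarith
  set μ := 2 / δ ^ 2 * Real.log (M / q) with hμ
  have hMq : 1 ≤ M / q := by rw [le_div_iff₀ hq0]; linarith
  have hμ0 : 0 ≤ μ := mul_nonneg (by positivity) (Real.log_nonneg hMq)
  refine ⟨q, Real.exp (μ * tEnd ^ 2), hq0, hq1, Real.exp_pos _, ?_⟩
  intro V _ _ _ H _ _ P 𝒯₀ hP hmon 𝒯 ℳ hrun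
  have hstep : ∀ k, P.eta (𝒯 (k + 1)) ^ 2 * Real.exp (μ * sqLength (𝒯 (k + 1))) ≤
      q * (P.eta (𝒯 k) ^ 2 * Real.exp (μ * sqLength (𝒯 k))) := by
    intro k
    have hr := hrun.refines k
    have hno := (hr.tiling hP.tiling).isNonoverlapping
    obtain ⟨hsub, hdoe⟩ := hrun.mark k
    rw [← eta_sq] at hdoe
    have hE : 0 ≤ P.eta (𝒯 k) ^ 2 := sq_nonneg _
    have hL := sqLength_bisect hno hsub
    rw [hrun.refine]
    by_cases hshort : ∀ T ∈ ℳ k, T.2 - T.1 ≤ δ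
    · have h1 := hP.eta_bisect_le hr hsub hshort hε hR
      rw [← hB] at h1
      have h2 : P.eta (bisect (𝒯 k) (ℳ k)) ^ 2 ≤ q * P.eta (𝒯 k) ^ 2 := by
        have h3 := mul_le_mul_of_nonneg_right hpert hE
        have h4 : (1 + ε) * (P.eta (𝒯 k) ^ 2 - 3 / 4 * ∑ T ∈ ℳ k, P.etaT (𝒯 k) T ^ 2) ≤
            (1 + ε) * (P.eta (𝒯 k) ^ 2 - 3 / 4 * (θ * P.eta (𝒯 k) ^ 2)) := by gcongr
        have h5 : (1 + ε) * (1 - 3 / 4 * θ) ≤ 1 - 2 * ε := by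
          rw [hεdef]; nlinarith
        have h6 := mul_le_mul_of_nonneg_right h5 hE
        rw [hq]
        linarith
      have h7 : sqLength (bisect (𝒯 k) (ℳ k)) ≤ sqLength (𝒯 k) := by
        rw [hL]
        linarith [show 0 ≤ ∑ T ∈ ℳ k, (T.2 - T.1) ^ 2 from
          Finset.sum_nonneg fun _ _ => sq_nonneg _]
      rw [← mul_assoc]
      exact mul_le_mul h2 (Real.exp_le_exp.2 (mul_le_mul_of_nonneg_left h7 hμ0))
        (Real.exp_pos _).le (by positivity)
    · push Not at hshort
      obtain ⟨T, hT, hTδ⟩ := hshort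
      have h1 := hmon _ _ hr (Refines.bisect hsub)
      have h2 : δ ^ 2 ≤ ∑ T ∈ ℳ k, (T.2 - T.1) ^ 2 :=
        (pow_le_pow_left₀ hδ.le hTδ.le 2).trans
          (Finset.single_le_sum (f := fun T : ℝ × ℝ => (T.2 - T.1) ^ 2)
            (fun _ _ => sq_nonneg _) hT)
      have h3 : μ * sqLength (bisect (𝒯 k) (ℳ k)) ≤ μ * sqLength (𝒯 k) - Real.log (M / q) := by
        have h4 : μ * (δ ^ 2 / 2) = Real.log (M / q) := by
          rw [hμ]
          field_simp
        rw [← h4, ← mul_sub]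
        refine mul_le_mul_of_nonneg_left ?_ hμ0
        rw [hL]
        linarith
      have h5 := Real.exp_le_exp.2 h3
      rw [Real.exp_sub, Real.exp_log (by positivity)] at h5
      calc _ ≤ M * P.eta (𝒯 k) ^ 2 * (Real.exp (μ * sqLength (𝒯 k)) / (M / q)) := by gcongr
        _ = _ := by field_simp
  intro k n
  have hiter : P.eta (𝒯 (k + n)) ^ 2 * Real.exp (μ * sqLength (𝒯 (k + n))) ≤
      q ^ n * (P.eta (𝒯 k) ^ 2 * Real.exp (μ * sqLength (𝒯 k))) := by
    induction n with
    | zero => simp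
    | succ n ih =>
      refine (hstep (k + n)).trans ?_
      rw [pow_succ' q n, mul_assoc q]
      exact mul_le_mul_of_nonneg_left ih hq0.le
  have h1 : (1 : ℝ) ≤ Real.exp (μ * sqLength (𝒯 (k + n))) :=
    Real.one_le_exp (mul_nonneg hμ0 (sqLength_nonneg _))
  have h2 : Real.exp (μ * sqLength (𝒯 k)) ≤ Real.exp (μ * tEnd ^ 2) :=
    Real.exp_le_exp.2 (mul_le_mul_of_nonneg_left
      (sqLength_le ((hrun.refines k).tiling hP.tiling)) hμ0)
  calc P.eta (𝒯 (k + n)) ^ 2 ≤ P.eta (𝒯 (k + n)) ^ 2 * Real.exp (μ * sqLength (𝒯 (k + n))) :=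
        le_mul_of_one_le_right (sq_nonneg _) h1
    _ ≤ q ^ n * (P.eta (𝒯 k) ^ 2 * Real.exp (μ * tEnd ^ 2)) := hiter.trans (by gcongr)
    _ = _ := by ring

/-! ### Optimality of Dörfler marking and of the rate -/

section

variable {V H : Type*} [NormedAddCommGroup V] [InnerProductSpace ℝ V] [FiniteDimensional ℝ V]
  [NormedAddCommGroup H] [InnerProductSpace ℝ H] {tEnd : ℝ} {P : ParabolicProblem V H tEnd}
  {𝒯₀ : TimeMesh}

/-- Optimality of Dörfler marking: if a refinement reduces the estimator by a sufficiently small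
factor, then the set from discrete reliability satisfies the Dörfler criterion. The numbers `τ`
and `ϰ` measure the gap `θ < θ⋆`. -/
theorem exists_isDoerfler {Cstab Cref Cdlr θ τ ϰ : ℝ} (h1 : P.A1 𝒯₀ Cstab)
    (h4 : P.A4 𝒯₀ Cref Cdlr) (hτ : 0 < τ)
    (hgap : θ * (1 + (1 + τ) * (Cstab ^ 2 * Cdlr ^ 2)) ≤ 1 - (1 + τ⁻¹) * ϰ)
    {𝒯 𝒯' : TimeMesh} (hr : Refines 𝒯₀ 𝒯) (hr' : Refines 𝒯 𝒯')
    (hred : P.eta 𝒯' ^ 2 ≤ ϰ * P.eta 𝒯 ^ 2) :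
    ∃ ℛ : TimeMesh, P.IsDoerfler θ 𝒯 ℛ ∧ (ℛ.card : ℝ) ≤ Cref * (𝒯 \ 𝒯').card := by
  obtain ⟨ℛ, hℛ, hsub, hcard, hd⟩ := h4 𝒯 𝒯' hr hr'
  refine ⟨ℛ, ⟨hℛ, ?_⟩, hcard⟩
  have e1 := h1 𝒯 𝒯' hr hr' (𝒯 ∩ 𝒯') subset_rfl
  rw [normX_cnDiff] at e1
  change P.normX (P.cnDiff 𝒯 𝒯') ^ 2 ≤ _ at hd
  set N := P.normX (P.cnDiff 𝒯 𝒯')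
  have hN : 0 ≤ N := Real.sqrt_nonneg _
  set ρ := ∑ T ∈ ℛ, P.etaT 𝒯 T ^ 2
  have hρ : 0 ≤ ρ := Finset.sum_nonneg fun _ _ => sq_nonneg _
  rw [← eta_sq]
  have hn : ∀ 𝒮, 0 ≤ ∑ T ∈ 𝒯 ∩ 𝒯', P.etaT 𝒮 T ^ 2 := fun _ =>
    Finset.sum_nonneg fun _ _ => sq_nonneg _
  have h5 : ∑ T ∈ 𝒯 ∩ 𝒯', P.etaT 𝒯 T ^ 2 ≤
      (1 + τ⁻¹) * P.eta 𝒯' ^ 2 + (1 + τ) * (Cstab ^ 2 * N ^ 2) := by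
    have h6 := (abs_le.1 e1).1
    have h7 := Real.sq_sqrt (hn 𝒯')
    have h8 := Real.sq_sqrt (hn 𝒯)
    set a := Real.sqrt (∑ T ∈ 𝒯 ∩ 𝒯', P.etaT 𝒯' T ^ 2)
    set b := Real.sqrt (∑ T ∈ 𝒯 ∩ 𝒯', P.etaT 𝒯 T ^ 2)
    have h9 : b ^ 2 ≤ (a + Cstab * N) ^ 2 := pow_le_pow_left₀ (Real.sqrt_nonneg _) (by linarith) 2
    have h10 : a ^ 2 ≤ P.eta 𝒯' ^ 2 := by
      rw [h7, eta_sq]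
      exact Finset.sum_le_sum_of_subset_of_nonneg Finset.inter_subset_right fun _ _ _ => sq_nonneg _
    have h11 : τ⁻¹ * (a - τ * (Cstab * N)) ^ 2 =
        τ⁻¹ * a ^ 2 - 2 * (a * (Cstab * N)) + τ * (Cstab * N) ^ 2 := by
      field_simp
      ring
    have h12 : 0 ≤ τ⁻¹ * (a - τ * (Cstab * N)) ^ 2 := by positivity
    have h13 : (1 + τ⁻¹) * a ^ 2 ≤ (1 + τ⁻¹) * P.eta 𝒯' ^ 2 := by gcongr
    nlinarith
  have h6 : ∑ T ∈ 𝒯 \ 𝒯', P.etaT 𝒯 T ^ 2 ≤ ρ :=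
    Finset.sum_le_sum_of_subset_of_nonneg hsub fun _ _ _ => sq_nonneg _
  have h7 : P.eta 𝒯 ^ 2 = ∑ T ∈ 𝒯 \ 𝒯', P.etaT 𝒯 T ^ 2 + ∑ T ∈ 𝒯 ∩ 𝒯', P.etaT 𝒯 T ^ 2 := by
    rw [eta_sq, ← Finset.sum_union (Finset.disjoint_sdiff_inter 𝒯 𝒯'), Finset.sdiff_union_inter]
  have h8 : (1 + τ⁻¹) * P.eta 𝒯' ^ 2 ≤ (1 + τ⁻¹) * (ϰ * P.eta 𝒯 ^ 2) := by gcongr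
  have h9 : (1 + τ) * (Cstab ^ 2 * N ^ 2) ≤ (1 + τ) * (Cstab ^ 2 * (Cdlr ^ 2 * ρ)) := by gcongr
  have h10 := mul_le_mul_of_nonneg_right hgap (sq_nonneg (P.eta 𝒯))
  set G := 1 + (1 + τ) * (Cstab ^ 2 * Cdlr ^ 2) with hG
  have hGpos : 0 < G := by positivity
  refine le_of_mul_le_mul_left ?_ hGpos
  calc G * (θ * P.eta 𝒯 ^ 2) = θ * G * P.eta 𝒯 ^ 2 := by ring
    _ ≤ (1 - (1 + τ⁻¹) * ϰ) * P.eta 𝒯 ^ 2 := h10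
    _ ≤ ρ + (1 + τ) * (Cstab ^ 2 * (Cdlr ^ 2 * ρ)) := by linarith
    _ = G * ρ := by rw [hG]; ring

/-- A mesh that realizes the best possible rate up to the tolerance `ε`. -/
theorem exists_mesh_of_Cbest {r : ℝ} (hr : 0 < r) (hfin : P.Cbest 𝒯₀ r < ⊤) {ε : ℝ} (hε : 0 < ε) :
    ∃ 𝒯 : TimeMesh, ∃ N : ℕ, Refines 𝒯₀ 𝒯 ∧ 𝒯.card ≤ 𝒯₀.card + N ∧ P.eta 𝒯 ≤ ε ∧
      (N : ℝ) ≤ ((P.Cbest 𝒯₀ r).toReal / ε) ^ (1 / r) := by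
  set b := (P.Cbest 𝒯₀ r).toReal
  have hb : 0 ≤ b := ENNReal.toReal_nonneg
  set x := (b / ε) ^ (1 / r)
  have hx : 0 ≤ x := by positivity
  have hlt : x < ⌊x⌋₊ + 1 := Nat.lt_floor_add_one x
  have hpow : b < ε * ((⌊x⌋₊ : ℝ) + 1) ^ r := by
    have h1 : x ^ r < ((⌊x⌋₊ : ℝ) + 1) ^ r := Real.rpow_lt_rpow hx hlt hr
    rw [← Real.rpow_mul (by positivity), one_div_mul_cancel hr.ne', Real.rpow_one,
      div_lt_iff₀ hε] at h1
    linarith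
  have hC : P.Cbest 𝒯₀ r < ENNReal.ofReal (ε * ((⌊x⌋₊ : ℝ) + 1) ^ r) := by
    rw [← ENNReal.ofReal_toReal hfin.ne]
    exact (ENNReal.ofReal_lt_ofReal_iff (by positivity)).2 hpow
  have h2 := (le_iSup (fun N : ℕ => ⨅ 𝒯 ∈ {𝒯 : TimeMesh | Refines 𝒯₀ 𝒯 ∧ 𝒯.card ≤ 𝒯₀.card + N},
    ENNReal.ofReal (P.eta 𝒯 * ((N : ℝ) + 1) ^ r)) ⌊x⌋₊).trans_lt hC
  simp only [iInf_lt_iff] at h2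
  obtain ⟨𝒯, ⟨h3, h4⟩, h5⟩ := h2
  refine ⟨𝒯, ⌊x⌋₊, h3, h4, ?_, Nat.floor_le hx⟩
  rw [ENNReal.ofReal_lt_ofReal_iff (by positivity)] at h5
  exact (lt_of_mul_lt_mul_right h5 (by positivity)).le

theorem eta_init_le_Cbest (ht : Tiling tEnd 𝒯₀) {r : ℝ} (hfin : P.Cbest 𝒯₀ r < ⊤) :
    P.eta 𝒯₀ ≤ (P.Cbest 𝒯₀ r).toReal := by
  rw [← ENNReal.ofReal_le_iff_le_toReal hfin.ne]
  refine le_trans ?_ (le_iSup (fun N : ℕ =>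
    ⨅ 𝒯 ∈ {𝒯 : TimeMesh | Refines 𝒯₀ 𝒯 ∧ 𝒯.card ≤ 𝒯₀.card + N},
    ENNReal.ofReal (P.eta 𝒯 * ((N : ℝ) + 1) ^ r)) 0)
  refine le_iInf₂ fun 𝒯 h𝒯 => ?_
  obtain ⟨h1, h2⟩ := h𝒯
  have h3 := h1.card_sdiff_add_card_le ht
  have h4 : 𝒯₀ ⊆ 𝒯 := by
    rw [← Finset.sdiff_eq_empty_iff_subset, ← Finset.card_eq_zero]
    omega
  have h5 : 𝒯₀ = 𝒯 := Finset.eq_of_subset_of_card_le h4 (by simpa using h2)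
  simp [h5]

/-- The number of marked elements is controlled by the best possible rate. -/
theorem IsAdaptiveRun.card_marked_le {Cstab Cref Cdlr θ τ ϰ M : ℝ} {𝒯 ℳ : ℕ → TimeMesh}
    (hrun : P.IsAdaptiveRun 𝒯₀ θ 𝒯 ℳ) (ht : Tiling tEnd 𝒯₀) (h1 : P.A1 𝒯₀ Cstab)
    (h4 : P.A4 𝒯₀ Cref Cdlr) (hτ : 0 < τ) (hCref : 0 ≤ Cref)
    (hgap : θ * (1 + (1 + τ) * (Cstab ^ 2 * Cdlr ^ 2)) ≤ 1 - (1 + τ⁻¹) * ϰ) (hϰ : 0 < ϰ)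
    (hM : 1 ≤ M)
    (hmon : ∀ 𝒯 𝒯' : TimeMesh, Refines 𝒯₀ 𝒯 → Refines 𝒯 𝒯' → P.eta 𝒯' ^ 2 ≤ M * P.eta 𝒯 ^ 2)
    {r : ℝ} (hr : 0 < r) (hfin : P.Cbest 𝒯₀ r < ⊤) {k : ℕ} (hk : 0 < P.eta (𝒯 k)) :
    ((ℳ k).card : ℝ) ≤
      Cref * ((P.Cbest 𝒯₀ r).toReal / (Real.sqrt (ϰ / M) * P.eta (𝒯 k))) ^ (1 / r) := by
  have hrk := hrun.refines k
  obtain ⟨𝒮, N, hS, hcard, heta, hN⟩ := exists_mesh_of_Cbest hr hfin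
    (show 0 < Real.sqrt (ϰ / M) * P.eta (𝒯 k) from mul_pos (Real.sqrt_pos.2 (by positivity)) hk)
  obtain ⟨𝒪, hO1, hO2, hO3⟩ := Refines.exists_overlay ht hS hrk
  have hred : P.eta 𝒪 ^ 2 ≤ ϰ * P.eta (𝒯 k) ^ 2 := by
    have h5 := pow_le_pow_left₀ (eta_nonneg 𝒮) heta 2
    rw [mul_pow, Real.sq_sqrt (by positivity)] at h5
    calc P.eta 𝒪 ^ 2 ≤ M * P.eta 𝒮 ^ 2 := hmon _ _ hS hO1
      _ ≤ M * (ϰ / M * P.eta (𝒯 k) ^ 2) := by gcongr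
      _ = _ := by field_simp
  obtain ⟨ℛ, hℛ, hℛc⟩ := exists_isDoerfler h1 h4 hτ hgap hrk hO2 hred
  have h6 := hO2.card_sdiff_add_card_le (hrk.tiling ht)
  have h7 : (𝒯 k \ 𝒪).card ≤ N := by omega
  calc ((ℳ k).card : ℝ) ≤ ℛ.card := by exact_mod_cast hrun.mark_minimal k ℛ hℛ
    _ ≤ Cref * (𝒯 k \ 𝒪).card := hℛc
    _ ≤ Cref * N := by gcongr
    _ ≤ _ := by gcongr

/-- Rate optimality from linear convergence and the bound on the number of marked elements: the
marked elements of all steps are summed by a geometric series. -/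
theorem IsAdaptiveRun.rate {θ Cref Λ q M ν r : ℝ} {𝒯 ℳ : ℕ → TimeMesh}
    (hrun : P.IsAdaptiveRun 𝒯₀ θ 𝒯 ℳ) (ht : Tiling tEnd 𝒯₀) (hr : 0 < r)
    (hfin : P.Cbest 𝒯₀ r < ⊤) (hCref : 0 ≤ Cref) (hΛ : 0 < Λ) (hq : 0 < q) (hq1 : q < 1)
    (hM : 1 ≤ M) (hν : 0 < ν)
    (hmon : ∀ 𝒯 𝒯' : TimeMesh, Refines 𝒯₀ 𝒯 → Refines 𝒯 𝒯' → P.eta 𝒯' ^ 2 ≤ M * P.eta 𝒯 ^ 2)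
    (hlin : ∀ k n, P.eta (𝒯 (k + n)) ^ 2 ≤ Λ * q ^ n * P.eta (𝒯 k) ^ 2)
    (hmark : ∀ k, 0 < P.eta (𝒯 k) → ((ℳ k).card : ℝ) ≤
      Cref * ((P.Cbest 𝒯₀ r).toReal / (ν * P.eta (𝒯 k))) ^ (1 / r)) (ℓ : ℕ) :
    P.eta (𝒯 ℓ) * ((𝒯 ℓ).card : ℝ) ^ r ≤
      (𝒯₀.card * Real.sqrt M ^ (1 / r) + Cref * (Real.sqrt Λ / ν) ^ (1 / r) *
        (1 - Real.sqrt q ^ (1 / r))⁻¹) ^ r * (P.Cbest 𝒯₀ r).toReal := by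
  set b := (P.Cbest 𝒯₀ r).toReal
  have hb : 0 ≤ b := ENNReal.toReal_nonneg
  have hr' : 0 < 1 / r := by positivity
  set ρ := Real.sqrt q ^ (1 / r)
  have hρ0 : 0 ≤ ρ := by positivity
  have hρ1 : ρ < 1 := Real.rpow_lt_one (Real.sqrt_nonneg _)
    (by rw [← Real.sqrt_one]; exact Real.sqrt_lt_sqrt hq.le hq1) hr'
  have hρ2 : 0 < 1 - ρ := by linarith
  set Q := 𝒯₀.card * Real.sqrt M ^ (1 / r) + Cref * (Real.sqrt Λ / ν) ^ (1 / r) * (1 - ρ)⁻¹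
  have hQ : 0 ≤ Q := by positivity
  rcases (eta_nonneg (P := P) (𝒯 ℓ)).eq_or_lt with h0 | hpos
  · rw [← h0, zero_mul]
    positivity
  set e := P.eta (𝒯 ℓ)
  have hle : ∀ k ≤ ℓ, e ≤ Real.sqrt Λ * Real.sqrt q ^ (ℓ - k) * P.eta (𝒯 k) := by
    intro k hk
    have h1 := hlin k (ℓ - k)
    rw [Nat.add_sub_cancel' hk] at h1
    refine abs_le_of_sq_le_sq' (h1.trans_eq ?_) (by positivity [eta_nonneg (P := P) (𝒯 k)]) |>.2
    rw [mul_pow, mul_pow, Real.sq_sqrt hΛ.le, ← pow_mul, mul_comm _ 2, pow_mul, Real.sq_sqrt hq.le]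
  set Z := b / e
  have hZ : 0 ≤ Z := by positivity
  have hmk : ∀ k < ℓ, ((ℳ k).card : ℝ) ≤
      Cref * (Real.sqrt Λ / ν) ^ (1 / r) * Z ^ (1 / r) * ρ ^ (ℓ - k) := by
    intro k hk
    have h1 := hle k hk.le
    have hek : 0 < P.eta (𝒯 k) := by
      rcases (eta_nonneg (P := P) (𝒯 k)).eq_or_lt with h | h
      · rw [← h, mul_zero] at h1; linarith
      · exact h
    have h2 : b / (ν * P.eta (𝒯 k)) ≤ Real.sqrt Λ / ν * Z * Real.sqrt q ^ (ℓ - k) := by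
      rw [div_le_iff₀ (by positivity)]
      calc b = Z * e := by simp only [Z]; field_simp
        _ ≤ Z * (Real.sqrt Λ * Real.sqrt q ^ (ℓ - k) * P.eta (𝒯 k)) := by gcongr
        _ = _ := by field_simp
    have h3 : ρ ^ (ℓ - k) = (Real.sqrt q ^ (ℓ - k)) ^ (1 / r) := by
      simp only [ρ]
      rw [← Real.rpow_natCast, ← Real.rpow_natCast, ← Real.rpow_mul (Real.sqrt_nonneg _),
        ← Real.rpow_mul (Real.sqrt_nonneg _), mul_comm]
    refine (hmark k hek).trans ?_
    rw [h3, mul_assoc, mul_assoc, ← Real.mul_rpow hZ (by positivity),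
      ← Real.mul_rpow (by positivity) (by positivity), ← mul_assoc _ Z]
    gcongr
  have hone : 1 ≤ Real.sqrt M ^ (1 / r) * Z ^ (1 / r) := by
    rw [← Real.mul_rpow (Real.sqrt_nonneg _) hZ]
    refine Real.one_le_rpow ?_ hr'.le
    have h1 : e ≤ Real.sqrt M * b := by
      have h2 := hmon 𝒯₀ (𝒯 ℓ) .refl (hrun.refines ℓ)
      have h3 : e ≤ Real.sqrt M * P.eta 𝒯₀ := by
        refine abs_le_of_sq_le_sq' (h2.trans_eq ?_)
          (mul_nonneg (Real.sqrt_nonneg _) (eta_nonneg _)) |>.2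
        rw [mul_pow, Real.sq_sqrt (by linarith)]
      exact h3.trans (mul_le_mul_of_nonneg_left (eta_init_le_Cbest ht hfin) (Real.sqrt_nonneg _))
    simp only [Z]
    rw [← mul_div_assoc, le_div_iff₀ hpos]
    linarith
  have hgeom : ∑ k ∈ Finset.range ℓ, ρ ^ (ℓ - k) ≤ (1 - ρ)⁻¹ := by
    have h1 : ∑ k ∈ Finset.range ℓ, ρ ^ (ℓ - k) ≤ ∑ k ∈ Finset.range (ℓ + 1), ρ ^ (ℓ - k) :=
      Finset.sum_le_sum_of_subset_of_nonneg (Finset.range_subset_range.2 (by omega))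
        fun _ _ _ => by positivity
    have h2 := Finset.sum_range_reflect (fun j => ρ ^ j) (ℓ + 1)
    simp only [Nat.add_sub_cancel] at h2
    refine h1.trans (h2.trans_le ?_)
    rw [← tsum_geometric_of_lt_one hρ0 hρ1]
    exact (summable_geometric_of_lt_one hρ0 hρ1).sum_le_tsum _ fun _ _ => by positivity
  have hcard : ((𝒯 ℓ).card : ℝ) ≤ Q * Z ^ (1 / r) := by
    rw [hrun.card_eq ht ℓ]
    push_cast
    have h1 : (𝒯₀.card : ℝ) ≤ 𝒯₀.card * (Real.sqrt M ^ (1 / r) * Z ^ (1 / r)) :=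
      le_mul_of_one_le_right (by positivity) hone
    have h2 : ∑ k ∈ Finset.range ℓ, ((ℳ k).card : ℝ) ≤
        Cref * (Real.sqrt Λ / ν) ^ (1 / r) * Z ^ (1 / r) * (1 - ρ)⁻¹ := by
      refine (Finset.sum_le_sum fun k hk => hmk k (Finset.mem_range.1 hk)).trans ?_
      rw [← Finset.mul_sum]
      exact mul_le_mul_of_nonneg_left hgeom (by positivity)
    calc _ ≤ _ := add_le_add h1 h2
      _ = _ := by simp only [Q]; ring
  calc e * ((𝒯 ℓ).card : ℝ) ^ r ≤ e * (Q * Z ^ (1 / r)) ^ r := by gcongr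
    _ = e * (Q ^ r * Z) := by
      rw [Real.mul_rpow hQ (by positivity), ← Real.rpow_mul hZ, one_div_mul_cancel hr.ne',
        Real.rpow_one]
    _ = Q ^ r * b := by simp only [Z]; field_simp

end

end ParabolicProblem

end AdaptiveTime


theorem theorem8p6 (tEnd : ℝ) (htEnd : 0 < tEnd) (𝒯₀ : TimeMesh) (h𝒯₀ : IsPartition tEnd 𝒯₀)
    (c C Cinv κ : ℝ) (hc : 0 < c) (hC : 0 < C) (hCinv : 0 < Cinv) (hκ : 0 < κ) :
    -- The scheme is uniquely solvable on all admissible meshes, and (A1), (A2), (A4) hold with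
    -- constants that are the same for all problems with the given parameters.
    (∃ Cstab Cred Cref Cdlr qred : ℝ, 1 ≤ Cstab ∧ 1 ≤ Cred ∧ 1 ≤ Cref ∧ 1 ≤ Cdlr ∧
      0 ≤ qred ∧ qred < 1 ∧
      ∀ (V : Type*) [NormedAddCommGroup V] [InnerProductSpace ℝ V] [FiniteDimensional ℝ V]
        (H : Type*) [NormedAddCommGroup H] [InnerProductSpace ℝ H]
        (P : ParabolicProblem V H tEnd) (h s : ℝ), 0 < h → 0 < s →
        P.IsAdmissible 𝒯₀ c C Cinv κ h s →
        (∀ 𝒯 : TimeMesh, Refines 𝒯₀ 𝒯 →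
          P.IsCrankNicolson 𝒯 (P.cn 𝒯) ∧
          ∀ v : ℝ → V, P.IsCrankNicolson 𝒯 v → Set.EqOn v (P.cn 𝒯) (Set.Icc 0 tEnd)) ∧
        P.A1 𝒯₀ Cstab ∧ P.A2 𝒯₀ qred Cred ∧ P.A4 𝒯₀ Cref Cdlr) ∧
    -- Rate-optimality for all `0 < θ < θ⋆`, where `θ⋆ = (1 + Cstab² Cdlr²)⁻¹` for any constants
    -- that are admissible in (A1) and (A4).
    (∀ Cstab Cref Cdlr : ℝ, 1 ≤ Cstab → 1 ≤ Cref → 1 ≤ Cdlr →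
      ∀ θ : ℝ, 0 < θ → θ < (1 + Cstab ^ 2 * Cdlr ^ 2)⁻¹ → ∀ r : ℝ, 0 < r →
      ∃ Copt : ℝ, 0 < Copt ∧
      ∀ (V : Type*) [NormedAddCommGroup V] [InnerProductSpace ℝ V] [FiniteDimensional ℝ V]
        (H : Type*) [NormedAddCommGroup H] [InnerProductSpace ℝ H]
        (P : ParabolicProblem V H tEnd) (h s : ℝ), 0 < h → 0 < s →
        P.IsAdmissible 𝒯₀ c C Cinv κ h s →
        P.A1 𝒯₀ Cstab → P.A4 𝒯₀ Cref Cdlr →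
        ∀ 𝒯 ℳ : ℕ → TimeMesh, P.IsAdaptiveRun 𝒯₀ θ 𝒯 ℳ →
          P.Cbest 𝒯₀ r < ⊤ →
          ⨆ ℓ : ℕ, ENNReal.ofReal (P.eta (𝒯 ℓ) * ((𝒯 ℓ).card : ℝ) ^ r)
            ≤ ENNReal.ofReal Copt * P.Cbest 𝒯₀ r) := by
  have ht := h𝒯₀.tiling htEnd
  obtain ⟨T₀, hT₀⟩ := ht.nonempty htEnd
  have hT₀lt : 0 < T₀.2 - T₀.1 := sub_pos.2 (h𝒯₀.nondegenerate T₀ hT₀)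
  set K := Cinv / (κ * (T₀.2 - T₀.1))
  have hK : 0 < K := by positivity
  set Sₐ := 1 + tEnd * (C * K) with hSₐ
  set Rₐ := 1 + 2 * (tEnd * (C * K)) ^ 2 with hRₐ
  set D₀ := 2 / c ^ 2 + (tEnd ^ 2 / 2 * K ^ 2 + 1) * (2 * (c ^ 2 + C ^ 2) / c ^ 2)
  have hD₀ : 0 ≤ D₀ := by positivity
  have hSₐ1 : 1 ≤ Sₐ := le_add_of_nonneg_right (by positivity)
  have hRₐ1 : 1 ≤ Rₐ := le_add_of_nonneg_right (by positivity)
  have hD : D₀ ≤ (1 + D₀) ^ 2 := by nlinarith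
  constructor
  · refine ⟨Sₐ, Rₐ, 1, 1 + D₀, 1 / 2, hSₐ1, hRₐ1, le_rfl, by linarith, by norm_num, by norm_num, ?_⟩
    intro V _ _ _ H _ _ P h s hh _ hadm
    have hP := hadm.isStable P ht hc hC hCinv hκ hh hT₀
    refine ⟨fun 𝒯 hr => ⟨hP.isCrankNicolson hr, fun v hv => ?_⟩, hP.A1 (by linarith),
      hP.A2 (by linarith), hP.A4 hD⟩
    exact hv.eqOn P hc hP.coercive (hr.tiling ht) (hP.isCrankNicolson hr)
  · intro Cstab Cref Cdlr hs href hdlr θ hθ hθs r hr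
    set X := Cstab ^ 2 * Cdlr ^ 2
    have hX : 0 < X := by positivity
    have hgap0 : 0 < 1 - θ * (1 + X) := by
      have := (lt_inv_comm₀ hθ (by positivity)).1 hθs
      have h2 : θ * (1 + X) < θ * θ⁻¹ := mul_lt_mul_of_pos_left this hθ
      rw [mul_inv_cancel₀ hθ.ne'] at h2
      linarith
    have hθX : θ * X < 1 := by nlinarith
    have hθ1 : θ < 1 := by nlinarith
    -- Half of the gap `1 - θ / θ⋆` absorbs each of the two perturbations.
    set τ := (1 - θ * (1 + X)) / 2
    have hτ : 0 < τ := by positivity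
    set ϰ := τ / (1 + τ⁻¹)
    have hϰ : 0 < ϰ := by positivity
    have hgap : θ * (1 + (1 + τ) * X) ≤ 1 - (1 + τ⁻¹) * ϰ := by
      have h1 : (1 + τ⁻¹) * ϰ = τ := mul_div_cancel₀ _ (by positivity)
      rw [h1]
      have h2 : τ * (θ * X) ≤ τ * 1 := by gcongr
      have h3 : 2 * τ = 1 - θ * (1 + X) := by simp only [τ]; ring
      linarith
    set M := 3 + (Rₐ + 2 * Sₐ ^ 2) * (1 + D₀) ^ 2
    have hM : 1 ≤ M := by
      have : 0 ≤ (Rₐ + 2 * Sₐ ^ 2) * (1 + D₀) ^ 2 := by positivity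
      linarith
    obtain ⟨q, Λ, hq, hq1, hΛ, hlin⟩ := ParabolicProblem.exists_linear_convergence
      (tEnd := tEnd) (C := C) (K := K) hc hM hθ hθ1
    have hn : 0 < 𝒯₀.card := Finset.card_pos.2 ⟨T₀, hT₀⟩
    refine ⟨(𝒯₀.card * Real.sqrt M ^ (1 / r) + Cref * (Real.sqrt Λ / Real.sqrt (ϰ / M)) ^ (1 / r) *
      (1 - Real.sqrt q ^ (1 / r))⁻¹) ^ r, ?_, ?_⟩
    · have h1 : Real.sqrt q ^ (1 / r) < 1 := Real.rpow_lt_one (Real.sqrt_nonneg _)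
        (by rw [← Real.sqrt_one]; exact Real.sqrt_lt_sqrt hq.le hq1) (by positivity)
      have h2 : 0 < 1 - Real.sqrt q ^ (1 / r) := by linarith
      have h3 : 0 < Real.sqrt M := Real.sqrt_pos.2 (by linarith)
      positivity
    · intro V _ _ _ H _ _ P h s hh _ hadm h1 h4 𝒯 ℳ hrun hfin
      have hP := hadm.isStable P ht hc hC hCinv hκ hh hT₀
      have hmon : ∀ 𝒯 𝒯' : TimeMesh, Refines 𝒯₀ 𝒯 → Refines 𝒯 𝒯' →
          P.eta 𝒯' ^ 2 ≤ M * P.eta 𝒯 ^ 2 := fun 𝒯 𝒯' hr hr' =>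
        ParabolicProblem.eta_sq_le_of_refines hSₐ1 hRₐ1 (hP.A1 (by linarith)) (hP.A2 (by linarith))
          (hP.A4 hD) hr hr'
      refine iSup_le fun ℓ => ?_
      rw [← ENNReal.ofReal_toReal hfin.ne, ← ENNReal.ofReal_mul' ENNReal.toReal_nonneg]
      refine ENNReal.ofReal_le_ofReal (hrun.rate ht hr hfin (by linarith) hΛ hq hq1 hM
        (Real.sqrt_pos.2 (by positivity)) hmon (hlin V H P 𝒯₀ hP hmon 𝒯 ℳ hrun) (fun k hk => ?_) ℓ)
      exact hrun.card_marked_le ht h1 h4 hτ (by linarith) hgap hϰ hM hmon hr hfin hk
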